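/- Conventions. Positive integers are denoted by $\mathbb{N}$; $\lambda$ is the empty word; alphabets are finite. Two languages $L_1,L_2$ are considered equal if $L_1\setminus\{\lambda\}=L_2\setminus\{\lambda\}$. $\mathrm{CF}$ stands for context-free rules $A\to z$ ($A$ a nonterminal, $z$ a word over nonterminals and terminals), $\mathrm{CF}-\lambda$ for those with $z\neq\lambda$. The notation $\mathrm{CF}[-\lambda]$ means that the assertion holds both with $\mathrm{CF}$ and with $\mathrm{CF}-\lambda$ (the same choice on both sides). A programmed grammar (without appearance checking) has disjoint alphabets $N$, $T$ of nonterminals and terminals, a start symbol $S\in N$, a finite set $\Lambda$ of labels, each naming a rule of a finite set of rules, and success fields $\sigma(r)\subseteq\Lambda$. One writes $(x,r_1)\Rightarrow(y,r_2)$ if $y$ arises from $x$ by applying the rule named by $r_1$ at one occurrence and $r_2\in\sigma(r_1)$. Its language is $\{w\in T^*: (S,r_1)\Rightarrow^*(w,r_2)\text{ for some } r_1,r_2\in\Lambda\}$. A CD grammar system $G=(N,T,S,P_1,\dots,P_n)$ of degree $n\ge1$ has disjoint alphabets $N$, $T$ of nonterminals and terminals, a start symbol $S\in N$, and finite sets $P_1,\dots,P_n$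 of rules. Write $x\Rightarrow_i y$ if $y$ arises from $x$ by one application of a rule of $P_i$. For a mode $f$, write $x\Rightarrow_i^f y$ if $x\Rightarrow_i^m y$ for some $m\ge0$ such that: $m=k$ if $f$ is $=k$; $m\le k$ if $f$ is $\le k$; $m\ge k$ if $f$ is $\ge k$; there is no $z$ with $y\Rightarrow_i z$ if $f$ is $t$; both conditions hold if $f$ is $(f_1\wedge f_2)$. The language $L_f(G)$ consists of the $w\in T^*$ with $S\Rightarrow_{i_1}^f w_1\Rightarrow_{i_2}^f\cdots\Rightarrow_{i_m}^f w_m=w$ for some $m\ge1$ and some $i_1,\dots,i_m\in\{1,\dots,n\}$. $\mathcal{L}(\mathrm{CD}_\infty,X,f)$ is the family of languages $L_f(G)$, where $G$ is a CD grammar system of arbitrary degree with rules of type $X$. The index of a derivation of a terminal word is the maximal number of occurrences of nonterminals in a sentential form of it (for a CD grammar system, all sentential forms obtained by the single rewriting steps count, including those inside the steps $\Rightarrow_i^f$). The index of a generated word is the minimum of the indices of its derivations; the index of a grammar is the supremum of the indices of the words it generates; the index of a language with respect to a type of grammars is the infimum of the indices of the grammars of this type generating it. $\mathcal{L}_{\mathrm{fin}}(\mathrm{P},X)$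 and $\mathcal{L}_{\mathrm{fin}}(\mathrm{CD}_\infty,X,f)$ are the families of languages that are generated by programmed grammars (without appearance checking), respectively by CD grammar systems in mode $f$, with rules of type $X$, and whose index with respect to these grammars is finite. Theorem. Let $k,k'\in\mathbb{N}$, $k\ge2$, and $\Delta\in\{\le,=,\ge\}$. Then each of the following families of languages coincides with $\mathcal{L}_{\mathrm{fin}}(\mathrm{P},\mathrm{CF}[-\lambda])$: 1. $\mathcal{L}_{\mathrm{fin}}(\mathrm{CD}_\infty,\mathrm{CF}[-\lambda],t)$; 2. $\mathcal{L}_{\mathrm{fin}}(\mathrm{CD}_\infty,\mathrm{CF}[-\lambda],=k)$; 3. $\mathcal{L}_{\mathrm{fin}}(\mathrm{CD}_\infty,\mathrm{CF}[-\lambda],\ge k)$; 4. $\mathcal{L}(\mathrm{CD}_\infty,\mathrm{CF}[-\lambda],(t\wedge{=k}))$; 5. $\mathcal{L}(\mathrm{CD}_\infty,\mathrm{CF}[-\lambda],(t\wedge{\le k}))$; 6. $\mathcal{L}_{\mathrm{fin}}(\mathrm{CD}_\infty,\mathrm{CF}[-\lambda],(t\wedge\Delta k'))$. -/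

import Mathlib

namespace GrammarSystems

universe u

/-- Whether rules are arbitrary context-free rules (`CF`) or non-erasing ones (`CF - λ`). -/
inductive RuleType where
  | cf
  | cfLambdaFree

/-- The rule `r` is of the given type. -/
def RuleType.Allows {T : Type u} {N : Type} : RuleType → ContextFreeRule T N → Prop
  | .cf, _ => True
  | .cfLambdaFree, r => r.output ≠ []

/-- Sentential forms, i.e. words over `N ∪ T` (as a disjoint union). -/
abbrev Form (T : Type u) (N : Type) := List (Symbol T N)

/-- A terminal word, seen as a sentential form. -/
def ofWord {T : Type u} (N : Type) (w : List T) : Form T N := w.map Symbol.terminal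

/-- `|x|_N`, the number of occurrences of nonterminals in `x`. -/
def ntCount {T : Type u} {N : Type} (x : Form T N) : ℕ :=
  x.countP fun s => match s with
    | Symbol.nonterminal _ => true
    | Symbol.terminal _ => false

/-- Languages are identified when they differ at most in the empty word. -/
def EqModLambda {T : Type u} (L₁ L₂ : Language T) : Prop :=
  (L₁ : Set (List T)) \ {[]} = (L₂ : Set (List T)) \ {[]}

/-! ### Programmed grammars -/

/-- A programmed grammar `(N, T, P, S, Λ, σ, φ)` with context-free rules. -/
structure ProgrammedGrammar (T : Type u) where
  N : Type
  finiteN : Finite N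
  S : N
  P : Finset (ContextFreeRule T N)
  Label : Type
  finiteLabel : Finite Label
  /-- The rule named by a label. -/
  rule : Label → ContextFreeRule T N
  rule_mem : ∀ r, rule r ∈ P
  /-- Success fields. -/
  σ : Label → Set Label
  /-- Failure fields. -/
  φ : Label → Set Label

namespace ProgrammedGrammar

variable {T : Type u} (G : ProgrammedGrammar T)

/-- Pairs of a sentential form and a label. -/
abbrev Config := Form T G.N × G.Label

/-- One derivation step, either an application of the rule or a step in appearance checking mode. -/
def Step (c d : G.Config) : Prop :=
  ((G.rule c.2).Rewrites c.1 d.1 ∧ d.2 ∈ G.σ c.2) ∨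
    (c.1 = d.1 ∧ (¬ ∃ y, (G.rule c.2).Rewrites c.1 y) ∧ d.2 ∈ G.φ c.2)

/-- The generated language. -/
def language : Language T :=
  {w | ∃ r₁ r₂ : G.Label, Relation.ReflTransGen G.Step ([Symbol.nonterminal G.S], r₁)
    (ofWord G.N w, r₂)}

/-- `D` is a derivation `(S, r₁) = (w₁, r₁) ⟹ (w₂, r₂) ⟹ ⋯ ⟹ (wₙ, rₙ) = (w, rₙ)` of `w`. -/
def IsDerivation (D : List G.Config) (w : List T) : Prop :=
  D.IsChain G.Step ∧
    (∃ r, D.head? = some ([Symbol.nonterminal G.S], r)) ∧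
    (∃ r, D.getLast? = some (ofWord G.N w, r))

/-- `ind(D, G)`, the maximal number of nonterminal occurrences along `D`. -/
noncomputable def indDerivation (D : List G.Config) : ℕ∞ := ⨆ c ∈ D, (ntCount c.1 : ℕ∞)

/-- `ind(w, G)`. -/
noncomputable def indWord (w : List T) : ℕ∞ :=
  ⨅ (D : List G.Config) (_ : G.IsDerivation D w), G.indDerivation D

/-- `ind(G)`. -/
noncomputable def ind : ℕ∞ := ⨆ w ∈ G.language, G.indWord w

/-- Programmed grammars with rules of type `X` and without appearance checking. -/
def ofType (X : RuleType) : Set (ProgrammedGrammar T) :=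
  {G | (∀ r ∈ G.P, X.Allows r) ∧ ∀ r, G.φ r = ∅}

end ProgrammedGrammar

/-! ### CD grammar systems -/

/-- Derivation modes. -/
inductive Mode where
  | star
  | t
  | le (k : ℕ)
  | eq (k : ℕ)
  | ge (k : ℕ)
  | and (f₁ f₂ : Mode)

/-- A CD grammar system `(N, T, S, P₁, …, Pₙ)` of degree `n ≥ 1` with context-free rules. -/
structure CDSystem (T : Type u) where
  N : Type
  finiteN : Finite N
  S : N
  degree : ℕ
  one_le_degree : 1 ≤ degree
  P : Fin degree → Finset (ContextFreeRule T N)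

namespace CDSystem

variable {T : Type u} (G : CDSystem T)

/-- `x ⟹ᵢ y`, one rewriting step by component `i`. -/
def Step (i : Fin G.degree) (x y : Form T G.N) : Prop := ∃ r ∈ G.P i, r.Rewrites x y

/-- The predicate `P(f, m, i, y)` on the number `m` of steps and on the form `y` reached. -/
def ModePred (i : Fin G.degree) : Mode → ℕ → Form T G.N → Prop
  | .star, _, _ => True
  | .t, _, y => ¬ ∃ z, G.Step i y z
  | .le k, m, _ => m ≤ k
  | .eq k, m, _ => m = k
  | .ge k, m, _ => k ≤ m
  | .and f₁ f₂, m, y => ModePred i f₁ m y ∧ ModePred i f₂ m y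

/-- `B` lists the forms of a derivation `x = x₀ ⟹ᵢ x₁ ⟹ᵢ ⋯ ⟹ᵢ xₘ = y` by component `i`
that is admissible in mode `f`. -/
def IsBlock (f : Mode) (i : Fin G.degree) (x : Form T G.N) (B : List (Form T G.N))
    (y : Form T G.N) : Prop :=
  B.IsChain (G.Step i) ∧ B.head? = some x ∧ B.getLast? = some y ∧
    G.ModePred i f (B.length - 1) y

/-- `x ⟹ᵢᶠ y`. -/
def ModeStep (f : Mode) (i : Fin G.degree) (x y : Form T G.N) : Prop := ∃ B, G.IsBlock f i x B y

/-- The language `L_f(G)` generated by `G` in mode `f`. -/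
def language (f : Mode) : Language T :=
  {w | Relation.TransGen (fun x y => ∃ i, G.ModeStep f i x y) [Symbol.nonterminal G.S]
    (ofWord G.N w)}

/-- `D` lists all forms, including those inside the blocks, of a derivation from `x` to `y` that
consists of one or more successive blocks in mode `f`; the last form of a block is the first form
of the next block and is listed once. -/
inductive IsDerivationFrom (f : Mode) : Form T G.N → List (Form T G.N) → Form T G.N → Prop
  | single {i : Fin G.degree} {x y : Form T G.N} {B : List (Form T G.N)} :
      G.IsBlock f i x B y → IsDerivationFrom f x B y
  | cons {i : Fin G.degree} {x y z : Form T G.N} {B D : List (Form T G.N)} :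
      G.IsBlock f i x B y → IsDerivationFrom f y D z → IsDerivationFrom f x (B ++ D.tail) z

/-- `D` is a derivation of the terminal word `w` in mode `f`. -/
def IsDerivation (f : Mode) (D : List (Form T G.N)) (w : List T) : Prop :=
  G.IsDerivationFrom f [Symbol.nonterminal G.S] D (ofWord G.N w)

/-- `ind(D, G)`, the maximal number of nonterminal occurrences along `D`. -/
noncomputable def indDerivation (D : List (Form T G.N)) : ℕ∞ := ⨆ x ∈ D, (ntCount x : ℕ∞)

/-- `ind(w, G)`, for `G` working in mode `f`. -/
noncomputable def indWord (f : Mode) (w : List T) : ℕ∞ :=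
  ⨅ (D : List (Form T G.N)) (_ : G.IsDerivation f D w), G.indDerivation D

/-- `ind(G)`, for `G` working in mode `f`. -/
noncomputable def ind (f : Mode) : ℕ∞ := ⨆ w ∈ G.language f, G.indWord f w

/-- CD grammar systems (of any degree) with rules of type `X`. -/
def ofType (X : RuleType) : Set (CDSystem T) := {G | ∀ i, ∀ r ∈ G.P i, X.Allows r}

end CDSystem

/-! ### Families of languages

`C` is a class of grammars, with `lang` and `ind` giving the language and the index of a grammar. -/

section Families

variable {T : Type u} {Γ : Type*} (C : Set Γ) (lang : Γ → Language T) (ind : Γ → ℕ∞)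

/-- The family of languages generated by the grammars in `C`. -/
def family : Set (Language T) := {L | ∃ G ∈ C, EqModLambda (lang G) L}

/-- The index of a language with respect to the grammars in `C`. -/
noncomputable def indLanguage (L : Language T) : ℕ∞ :=
  ⨅ (G : Γ) (_ : G ∈ C) (_ : EqModLambda (lang G) L), ind G

/-- The languages of the family of index at most `n`. -/
def familyOfIndex (n : ℕ) : Set (Language T) :=
  {L | L ∈ family C lang ∧ indLanguage C lang ind L ≤ n}

/-- The languages of the family of finite index. -/
def familyOfFiniteIndex : Set (Language T) := ⋃ n ≥ 1, familyOfIndex C lang ind n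

end Families

/-- `ℒ_fin(P, X)`, over the terminal alphabet `T`. -/
def finP (T : Type u) (X : RuleType) : Set (Language T) :=
  familyOfFiniteIndex (ProgrammedGrammar.ofType X) ProgrammedGrammar.language
    ProgrammedGrammar.ind

/-- `ℒ(CD_∞, X, f)`, over the terminal alphabet `T`. -/
def allCD (T : Type u) (X : RuleType) (f : Mode) : Set (Language T) :=
  family (CDSystem.ofType X) fun G => G.language f

/-- `ℒ_fin(CD_∞, X, f)`, over the terminal alphabet `T`. -/
def finCD (T : Type u) (X : RuleType) (f : Mode) : Set (Language T) :=
  familyOfFiniteIndex (CDSystem.ofType X) (fun G => G.language f) fun G => G.ind f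

end GrammarSystems

/-! A bound `n` on the number of nonterminals makes a derivation finite-state. Number the
occurrences so that no numbered name occurs twice in a form; the list of names present then takes
finitely many values and fits into a finite control. In such a form a rule applies at one place
only, so rewriting is substitution, and whether a set of rules is still applicable (mode `t`) can be
read off the state. This normal form is `Machine`. It is obtained from `Controlled`, where a finite
control may inspect the nonterminals present; `Controlled.toMachine_language` is the equivalence.

Programmed grammars and CD systems, cut off at index `n`, are both controlled grammars: the control
is the current label, respectively the active component with a capped step count. Hence both yield
machines. A machine in turn is a programmed grammar with its transitions as labels
(`mem_finP_of_machine`), which gives `finCD_subset_finP`.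

For the converse, a CD system has no control, so the state of the machine is stored in one
nonterminal occurrence, the head, which must be the next one rewritten. If the next head is among
the inserted names, a transition is a single rule. If it is an older name, two occurrences must
change together. In terminating modes this takes three `guarded` components: rules `B → B` keep a
block from terminating while a forbidden `B` is present, and `A → A` pads a block to any positive
length (`Machine.mem_finCD_of_terminating`). In the modes `= k` and `≥ k` one component does it in
exactly `k` steps, `k - 1` for the old head and one for the new: each rule lowers a weight by one,
and the weight is at most `k`, so a block of `k` steps has to do everything
(`Machine.mem_finCD_of_counting`).

In the modes `t ∧ = k` and `t ∧ ≤ k` finite index is automatic (`allCD_subset_finCD`): a component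
that can rewrite `A` removes all copies of `A` in at most `k` steps, so no successful derivation has
more than `k` copies of `A` at the start of a block. -/

namespace GrammarSystems

universe u

/-! ### Sentential forms, their nonterminals, and substitution -/

section Words

variable {T : Type u} {N M L : Type}

/-- The nonterminal occurrences of a sentential form, from left to right. -/
def nts (x : Form T N) : List N :=
  x.flatMap fun s => match s with
    | .nonterminal A => [A]
    | .terminal _ => []

/-- The image of a sentential form under a substitution of the nonterminals. -/
def bindN (g : N → Form T M) (x : Form T N) : Form T M :=
  x.flatMap fun s => match s with
    | .nonterminal A => g A
    | .terminal a => [.terminal a]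

@[simp] theorem nts_nil : nts ([] : Form T N) = [] := rfl
@[simp] theorem nts_nonterminal_cons (A : N) (x : Form T N) :
    nts (.nonterminal A :: x) = A :: nts x := rfl
@[simp] theorem nts_terminal_cons (a : T) (x : Form T N) : nts (.terminal a :: x) = nts x := rfl
@[simp] theorem nts_append (x y : Form T N) : nts (x ++ y) = nts x ++ nts y :=
  List.flatMap_append
@[simp] theorem bindN_nil (g : N → Form T M) : bindN g [] = [] := rfl
@[simp] theorem bindN_nonterminal_cons (g : N → Form T M) (A : N) (x : Form T N) :
    bindN g (.nonterminal A :: x) = g A ++ bindN g x := rfl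
@[simp] theorem bindN_terminal_cons (g : N → Form T M) (a : T) (x : Form T N) :
    bindN g (.terminal a :: x) = .terminal a :: bindN g x := rfl
@[simp] theorem bindN_append (g : N → Form T M) (x y : Form T N) :
    bindN g (x ++ y) = bindN g x ++ bindN g y :=
  List.flatMap_append

/-- Induction over sentential forms. -/
theorem form_induction {p : Form T N → Prop} (nil : p [])
    (nonterminal : ∀ A x, p x → p (.nonterminal A :: x))
    (terminal : ∀ a x, p x → p (.terminal a :: x)) (x : Form T N) : p x := by
  induction x with
  | nil => exact nil
  | cons s x ih =>
    cases s with
    | nonterminal A => exact nonterminal A x ih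
    | terminal a => exact terminal a x ih

theorem ntCount_eq (x : Form T N) : ntCount x = (nts x).length := by
  induction x using form_induction with
  | nil => rfl
  | nonterminal A x ih => simp [← ih, ntCount]
  | terminal a x ih => simp [← ih, ntCount]

@[simp] theorem nts_ofWord (w : List T) : nts (ofWord N w) = [] := by
  induction w with
  | nil => rfl
  | cons a w ih => simpa [ofWord] using ih

theorem nts_eq_nil {x : Form T N} : nts x = [] ↔ ∃ w, x = ofWord N w := by
  refine ⟨fun h => ?_, by rintro ⟨w, rfl⟩; simp⟩
  induction x using form_induction with
  | nil => exact ⟨[], rfl⟩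
  | nonterminal A x ih => simp at h
  | terminal a x ih =>
    obtain ⟨w, rfl⟩ := ih h
    exact ⟨a :: w, rfl⟩

@[simp] theorem bindN_ofWord (g : N → Form T M) (w : List T) :
    bindN g (ofWord N w) = ofWord M w := by
  induction w with
  | nil => rfl
  | cons a w ih => simpa [ofWord] using ih

theorem ofWord_injective : Function.Injective (ofWord (T := T) N) :=
  List.map_injective_iff.2 fun _ _ h => by simpa using h

theorem nts_bindN (g : N → Form T M) (x : Form T N) :
    nts (bindN g x) = (nts x).flatMap fun A => nts (g A) := by
  induction x using form_induction with
  | nil => rfl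
  | nonterminal A x ih => simp [ih]
  | terminal a x ih => simp [ih]

theorem mem_nts_bindN {g : N → Form T M} {x : Form T N} {B : M} :
    B ∈ nts (bindN g x) ↔ ∃ A ∈ nts x, B ∈ nts (g A) := by
  simp [nts_bindN]

theorem bindN_bindN (h : M → Form T L) (g : N → Form T M) (x : Form T N) :
    bindN h (bindN g x) = bindN (fun A => bindN h (g A)) x := by
  induction x using form_induction with
  | nil => rfl
  | nonterminal A x ih => simp [ih]
  | terminal a x ih => simp [ih]

theorem bindN_congr {g h : N → Form T M} {x : Form T N} (H : ∀ A ∈ nts x, g A = h A) :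
    bindN g x = bindN h x := by
  induction x using form_induction with
  | nil => rfl
  | nonterminal A x ih => simp_all
  | terminal a x ih => simp_all

theorem bindN_eq_self {g : N → Form T N} {x : Form T N}
    (H : ∀ A ∈ nts x, g A = [.nonterminal A]) : bindN g x = x := by
  induction x using form_induction with
  | nil => rfl
  | nonterminal A x ih => simp_all
  | terminal a x ih => simp_all

theorem nonterminal_mem_iff {x : Form T N} {A : N} : Symbol.nonterminal A ∈ x ↔ A ∈ nts x := by
  induction x using form_induction with
  | nil => simp
  | nonterminal B x ih => simp [ih]
  | terminal a x ih => simp [ih]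

open Classical in
/-- Replacing every occurrence of `A` by `z`. -/
noncomputable def subst (A : N) (z : Form T N) (x : Form T N) : Form T N :=
  bindN (fun B => if B = A then z else [.nonterminal B]) x

theorem subst_append (A : N) (z x y : Form T N) :
    subst A z (x ++ y) = subst A z x ++ subst A z y := bindN_append _ _ _

theorem subst_eq_self {A : N} {z x : Form T N} (h : A ∉ nts x) : subst A z x = x :=
  bindN_eq_self fun B hB => by rw [if_neg]; rintro rfl; exact h hB

@[simp] theorem subst_singleton (A : N) (z : Form T N) : subst A z [.nonterminal A] = z := by
  simp [subst]

theorem subst_split {A : N} {z p q : Form T N} (hp : A ∉ nts p) (hq : A ∉ nts q) :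
    subst A z (p ++ [.nonterminal A] ++ q) = p ++ z ++ q := by
  rw [subst_append, subst_append, subst_eq_self hp, subst_eq_self hq, subst_singleton]

theorem exists_split {A : N} {x : Form T N} (h : A ∈ nts x) :
    ∃ p q, x = p ++ [.nonterminal A] ++ q := by
  obtain ⟨p, q, h⟩ := List.append_of_mem (nonterminal_mem_iff.2 h)
  exact ⟨p, q, by simpa using h⟩

theorem notMem_of_nodup_split {A : N} {p q : Form T N}
    (h : (nts (p ++ [.nonterminal A] ++ q)).Nodup) : A ∉ nts p ∧ A ∉ nts q := by
  simp only [nts_append, nts_nonterminal_cons, nts_nil] at h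
  have h' := (List.perm_append_singleton A (nts p)).append_right (nts q) |>.nodup_iff.1 h
  simpa using (List.nodup_cons.1 h').1

/-- If no nonterminal occurs twice, then rewriting is substitution. -/
theorem rewrites_iff_of_nodup {x y : Form T N} (h : (nts x).Nodup) (r : ContextFreeRule T N) :
    r.Rewrites x y ↔ r.input ∈ nts x ∧ y = subst r.input r.output x := by
  rw [ContextFreeRule.rewrites_iff]
  constructor
  · rintro ⟨p, q, rfl, rfl⟩
    obtain ⟨hp, hq⟩ := notMem_of_nodup_split h
    exact ⟨by simp, (subst_split hp hq).symm⟩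
  · rintro ⟨hA, rfl⟩
    obtain ⟨p, q, rfl⟩ := exists_split hA
    obtain ⟨hp, hq⟩ := notMem_of_nodup_split h
    exact ⟨p, q, rfl, subst_split hp hq⟩

theorem Rewrites.input_mem {r : ContextFreeRule T N} {x y : Form T N} (h : r.Rewrites x y) :
    r.input ∈ nts x :=
  nonterminal_mem_iff.1 h.nonterminal_input_mem

theorem exists_rewrites_iff {r : ContextFreeRule T N} {x : Form T N} :
    (∃ y, r.Rewrites x y) ↔ r.input ∈ nts x := by
  refine ⟨fun ⟨y, h⟩ => Rewrites.input_mem h, fun h => ?_⟩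
  obtain ⟨p, q, rfl⟩ := exists_split h
  exact ⟨_, r.rewrites_of_exists_parts p q⟩

/-- A substitution that identifies both sides of a rule is invariant under rewriting. -/
theorem Rewrites.bindN_eq {r : ContextFreeRule T N} {x y : Form T N} (h : r.Rewrites x y)
    {g : N → Form T M} (hg : bindN g r.output = g r.input) : bindN g x = bindN g y := by
  obtain ⟨p, q, rfl, rfl⟩ := h.exists_parts
  simp [hg]

end Words

/-! ### Runs of one component with bounded index -/

section Runs

variable {T : Type u} {N : Type}

/-- Rewriting by one rule of the set `R`. -/
def RStep (R : Set (ContextFreeRule T N)) (x y : Form T N) : Prop := ∃ r ∈ R, r.Rewrites x y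

/-- `Run R b m x y`: there are `m` rewriting steps by rules of `R` from `x` to `y`, through forms
with at most `b` nonterminal occurrences. -/
inductive Run (R : Set (ContextFreeRule T N)) (b : ℕ∞) : ℕ → Form T N → Form T N → Prop
  | refl {x : Form T N} (h : (ntCount x : ℕ∞) ≤ b) : Run R b 0 x x
  | tail {m : ℕ} {x y z : Form T N} (h : Run R b m x y) (hs : RStep R y z)
      (hz : (ntCount z : ℕ∞) ≤ b) : Run R b (m + 1) x z

/-- The condition imposed by a mode on the number of steps and on the form reached. -/
def ModeOK (R : Set (ContextFreeRule T N)) : Mode → ℕ → Form T N → Prop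
  | .star, _, _ => True
  | .t, _, y => ¬ ∃ z, RStep R y z
  | .le k, m, _ => m ≤ k
  | .eq k, m, _ => m = k
  | .ge k, m, _ => k ≤ m
  | .and f₁ f₂, m, y => ModeOK R f₁ m y ∧ ModeOK R f₂ m y

/-- A step in mode `f`, through forms with at most `b` nonterminal occurrences. -/
def MStep (R : Set (ContextFreeRule T N)) (b : ℕ∞) (f : Mode) (x y : Form T N) : Prop :=
  ∃ m, Run R b m x y ∧ ModeOK R f m y

variable {R : Set (ContextFreeRule T N)} {b b' : ℕ∞} {m m' : ℕ} {x y z : Form T N} {f : Mode}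

/-- Applicability depends only on which nonterminals are present; this is what lets a finite control
decide the mode `t`. -/
theorem exists_rstep_iff : (∃ z, RStep R y z) ↔ ∃ r ∈ R, r.input ∈ nts y := by
  simp only [RStep, ← exists_rewrites_iff]
  exact ⟨fun ⟨z, r, h, h'⟩ => ⟨r, h, z, h'⟩, fun ⟨r, h, z, h'⟩ => ⟨z, r, h, h'⟩⟩

theorem Run.le_right (h : Run R b m x y) : (ntCount y : ℕ∞) ≤ b := by
  cases h with
  | refl h => exact h
  | tail _ _ h => exact h

theorem Run.mono (hb : b ≤ b') (h : Run R b m x y) : Run R b' m x y := by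
  induction h with
  | refl h => exact .refl (h.trans hb)
  | tail _ hs hz ih => exact .tail ih hs (hz.trans hb)

theorem MStep.mono (hb : b ≤ b') (h : MStep R b f x y) : MStep R b' f x y :=
  let ⟨m, h, h'⟩ := h
  ⟨m, h.mono hb, h'⟩

theorem Run.trans (h : Run R b m x y) (h' : Run R b m' y z) : Run R b (m + m') x z := by
  induction h' with
  | refl _ => exact h
  | tail _ hs hz ih => exact .tail (ih h) hs hz

theorem run_iff_exists_chain : Run R b m x y ↔ ∃ B : List (Form T N), B.IsChain (RStep R) ∧
    B.head? = some x ∧ B.getLast? = some y ∧ B.length - 1 = m ∧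
      ∀ z ∈ B, (ntCount z : ℕ∞) ≤ b := by
  constructor
  · intro h
    induction h with
    | @refl x h => exact ⟨[x], by simp, rfl, rfl, rfl, by simpa using h⟩
    | @tail m x y z h hs hz ih =>
      obtain ⟨B, hB, hx, hy, hm, hb⟩ := ih
      have hne : B ≠ [] := by rintro rfl; simp at hx
      have := List.length_pos_iff.2 hne
      refine ⟨B ++ [z], ?_, by simp [hx], by simp, by simp; omega, ?_⟩
      · rw [List.isChain_append]
        refine ⟨hB, by simp, fun a ha c hc => ?_⟩
        rw [hy] at ha
        simp at ha hc
        exact ha ▸ hc ▸ hs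
      · intro w hw
        rcases List.mem_append.1 hw with hw | hw
        · exact hb w hw
        · rw [List.mem_singleton.1 hw]; exact hz
  · rintro ⟨B, hB, hx, hy, rfl, hb⟩
    induction B using List.reverseRecOn generalizing y with
    | nil => simp at hx
    | append_singleton B z ih =>
      simp at hy
      subst hy
      rcases List.eq_nil_or_concat B with rfl | ⟨B', a, rfl⟩
      · simp at hx
        subst hx
        exact .refl (hb _ (by simp))
      · rw [List.isChain_append] at hB
        simp only [List.concat_eq_append] at *
        have := ih (y := a) hB.1 (by simpa using hx) (by simp)
          fun w hw => hb w (List.mem_append_left _ hw)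
        have h2 := Run.tail this (hB.2.2 a (by simp) z (by simp)) (hb z (by simp))
        simpa using h2

/-- A run of `m` steps from a form with few nonterminals has few nonterminals throughout. -/
theorem Run.bounded {l c : ℕ} (hR : ∀ r ∈ R, r.output.length ≤ l) (h : Run R b m x y)
    (hx : ntCount x ≤ c) : Run R (c + m * l : ℕ) m x y ∧ ntCount y ≤ c + m * l := by
  induction h with
  | refl h => exact ⟨.refl (by simpa using hx), by simpa using hx⟩
  | @tail m x y z h hs hz ih =>
    obtain ⟨h1, h2⟩ := ih hx
    -- A step adds at most the nonterminals of the inserted right-hand side, hence at most `l`.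
    have h3 : ntCount z ≤ c + (m + 1) * l := by
      obtain ⟨r, hr, hs⟩ := hs
      obtain ⟨p, q, rfl, rfl⟩ := hs.exists_parts
      have h4 : ntCount r.output ≤ l := List.countP_le_length.trans (hR r hr)
      simp only [ntCount_eq, nts_append, List.length_append] at *
      rw [add_mul]
      omega
    exact ⟨.tail (h1.mono (by gcongr; omega)) hs (by exact_mod_cast h3), h3⟩

end Runs

/-! ### Derivations of bounded index as transitive closures -/

namespace CDSystem

variable {T : Type u} (G : CDSystem T) {b : ℕ∞} {f : Mode}

theorem modePred_iff {i : Fin G.degree} {m : ℕ} {y : Form T G.N} :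
    G.ModePred i f m y ↔ ModeOK (G.P i : Set _) f m y := by
  induction f with
  | and f₁ f₂ h₁ h₂ => exact and_congr h₁ h₂
  | _ => exact Iff.rfl

/-- A step in mode `f` by some component, through forms with at most `b` nonterminal
occurrences. -/
def BStep (b : ℕ∞) (f : Mode) (x y : Form T G.N) : Prop := ∃ i, MStep (G.P i : Set _) b f x y

/-- The words that have a derivation of index at most `b`. -/
def boundedLanguage (b : ℕ∞) (f : Mode) : Language T :=
  {w | Relation.TransGen (G.BStep b f) [.nonterminal G.S] (ofWord G.N w)}

variable {G}

theorem mstep_iff {i : Fin G.degree} {x y : Form T G.N} : MStep (G.P i : Set _) b f x y ↔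
    ∃ B, G.IsBlock f i x B y ∧ ∀ z ∈ B, (ntCount z : ℕ∞) ≤ b := by
  simp only [MStep, run_iff_exists_chain, IsBlock, modePred_iff]
  constructor
  · rintro ⟨m, ⟨B, h1, h2, h3, rfl, h4⟩, h5⟩
    exact ⟨B, ⟨h1, h2, h3, h5⟩, h4⟩
  · rintro ⟨B, ⟨h1, h2, h3, h5⟩, h4⟩
    exact ⟨_, ⟨B, h1, h2, h3, rfl, h4⟩, h5⟩

theorem boundedLanguage_mono {b' : ℕ∞} (h : b ≤ b') :
    G.boundedLanguage b f ≤ G.boundedLanguage b' f :=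
  fun _ hw => Relation.TransGen.mono (r := G.BStep b f) (p := G.BStep b' f)
    (fun _ _ ⟨i, h'⟩ => ⟨i, h'.mono h⟩) _ _ hw

theorem language_eq : G.language f = G.boundedLanguage ⊤ f := by
  have : (fun x y => ∃ i, G.ModeStep f i x y) = G.BStep ⊤ f := by
    ext x y
    simp [ModeStep, BStep, mstep_iff]
  unfold language boundedLanguage
  rw [this]

theorem IsDerivationFrom.head? {x y : Form T G.N} {D : List (Form T G.N)}
    (h : G.IsDerivationFrom f x D y) : D.head? = some x := by
  cases h with
  | single h => exact h.2.1
  | cons h _ => rw [List.head?_append, h.2.1]; rfl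

/-- Replaces explicit lists of forms by a relation whose steps carry the index bound, so that later
arguments are inductions on a closure. -/
theorem transGen_bstep_iff {x y : Form T G.N} : Relation.TransGen (G.BStep b f) x y ↔
    ∃ D, G.IsDerivationFrom f x D y ∧ ∀ z ∈ D, (ntCount z : ℕ∞) ≤ b := by
  constructor
  · intro h
    induction h using Relation.TransGen.head_induction_on with
    | single h =>
      obtain ⟨i, h⟩ := h
      obtain ⟨B, hB, hb⟩ := mstep_iff.1 h
      exact ⟨B, .single hB, hb⟩
    | head h _ ih =>
      obtain ⟨i, h⟩ := h
      obtain ⟨B, hB, hb⟩ := mstep_iff.1 h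
      obtain ⟨D, hD, hb'⟩ := ih
      refine ⟨_, .cons hB hD, fun z hz => ?_⟩
      rcases List.mem_append.1 hz with hz | hz
      · exact hb z hz
      · exact hb' z (List.mem_of_mem_tail hz)
  · rintro ⟨D, hD, hb⟩
    induction hD with
    | single h => exact .single ⟨_, mstep_iff.2 ⟨_, h, hb⟩⟩
    | @cons i x y z B D hB hD ih =>
      refine .head ⟨_, mstep_iff.2 ⟨_, hB, fun z hz => hb z (List.mem_append_left _ hz)⟩⟩
        (ih fun z hz => ?_)
      -- The first form of `D` is not listed in `D.tail`; its bound comes from its occurrence as the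
      -- last form of `B`.
      have hh := hD.head?
      cases D with
      | nil => simp at hz
      | cons d D =>
        simp at hh
        subst hh
        rcases List.mem_cons.1 hz with rfl | hz
        · exact hb _ (List.mem_append_left _ (List.mem_of_getLast? hB.2.2.1))
        · exact hb _ (List.mem_append_right _ hz)

end CDSystem

namespace ProgrammedGrammar

variable {T : Type u} (G : ProgrammedGrammar T) {b : ℕ∞}

/-- A derivation step between forms with at most `b` nonterminal occurrences. -/
def BStep (b : ℕ∞) (c d : G.Config) : Prop :=
  G.Step c d ∧ (ntCount c.1 : ℕ∞) ≤ b ∧ (ntCount d.1 : ℕ∞) ≤ b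

/-- The words that have a derivation of index at most `b`. -/
def boundedLanguage (b : ℕ∞) : Language T :=
  {w | ∃ r₁ r₂ : G.Label, Relation.ReflTransGen (G.BStep b) ([.nonterminal G.S], r₁)
    (ofWord G.N w, r₂)}

variable {G}

theorem boundedLanguage_mono {b' : ℕ∞} (h : b ≤ b') :
    G.boundedLanguage b ≤ G.boundedLanguage b' :=
  fun _ ⟨r₁, r₂, hw⟩ => ⟨r₁, r₂,
    Relation.ReflTransGen.mono (r := G.BStep b) (p := G.BStep b')
      (fun _ _ h' => ⟨h'.1, h'.2.1.trans h, h'.2.2.trans h⟩) _ _ hw⟩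

theorem language_eq : G.language = G.boundedLanguage ⊤ := by
  have : G.Step = G.BStep ⊤ := by
    ext x y
    simp [BStep]
  unfold language boundedLanguage
  rw [this]

theorem reflTransGen_bstep_iff {c d : G.Config} :
    (Relation.ReflTransGen (G.BStep b) c d ∧ (ntCount d.1 : ℕ∞) ≤ b) ↔
    ∃ D : List G.Config, D.IsChain G.Step ∧ D.head? = some c ∧ D.getLast? = some d ∧
      ∀ z ∈ D, (ntCount z.1 : ℕ∞) ≤ b := by
  constructor
  · rintro ⟨h, hd⟩
    induction h using Relation.ReflTransGen.head_induction_on with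
    | refl => exact ⟨[d], by simp, rfl, rfl, by simpa using hd⟩
    | @head c e h _ ih =>
      obtain ⟨D, h1, h2, h3, h4⟩ := ih
      refine ⟨c :: D, ?_, rfl, by simp [List.getLast?_cons, h3],
        by simpa using ⟨h.2.1, by simpa using h4⟩⟩
      cases D with
      | nil => simp
      | cons a D =>
        simp at h2
        subst h2
        exact List.isChain_cons_cons.2 ⟨h.1, h1⟩
  · rintro ⟨D, h1, h2, h3, h4⟩
    refine ⟨?_, h4 _ (List.mem_of_getLast? h3)⟩
    induction D generalizing c with
    | nil => simp at h2
    | cons a D ih =>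
      simp at h2
      subst h2
      cases D with
      | nil =>
        simp at h3
        subst h3
        exact .refl
      | cons e D =>
        rw [List.isChain_cons_cons] at h1
        exact .head ⟨h1.1, h4 _ (by simp), h4 _ (by simp)⟩
          (ih h1.2 rfl (by simpa [List.getLast?_cons] using h3)
            fun z hz => h4 z (List.mem_cons_of_mem _ hz))

end ProgrammedGrammar

/-! ### Finite index as an equality of languages -/

section Index

/-- An infimum in `ℕ∞` below a finite bound is attained below it: otherwise all values, and so the
infimum, would be at least `n + 1`. -/
theorem iInf₂_le_natCast {ι : Type*} {p : ι → Prop} {g : ι → ℕ∞} {n : ℕ} :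
    (⨅ (i : ι) (_ : p i), g i) ≤ (n : ℕ∞) ↔ ∃ i, p i ∧ g i ≤ n := by
  refine ⟨fun h => ?_, fun ⟨i, hp, hi⟩ => (iInf₂_le i hp).trans hi⟩
  by_contra! H
  have h2 : ((n : ℕ∞) + 1) ≤ ⨅ (i : ι) (_ : p i), g i :=
    le_iInf₂ fun i hi => Order.add_one_le_of_lt (H i hi)
  exact absurd (h2.trans h) (not_le.2 (by exact_mod_cast Nat.lt_succ_self n))

variable {T : Type u} {n : ℕ}

theorem CDSystem.ind_le_iff {G : CDSystem T} {f : Mode} :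
    G.ind f ≤ n ↔ G.language f = G.boundedLanguage n f := by
  have key : ∀ w, G.indWord f w ≤ n ↔ w ∈ G.boundedLanguage n f := by
    intro w
    rw [indWord, iInf₂_le_natCast]
    simp only [indDerivation, iSup₂_le_iff]
    exact transGen_bstep_iff.symm
  simp only [ind, iSup₂_le_iff, key]
  rw [language_eq]
  exact ⟨fun h => le_antisymm h (boundedLanguage_mono le_top), fun h w hw => h ▸ hw⟩

theorem ProgrammedGrammar.ind_le_iff {G : ProgrammedGrammar T} :
    G.ind ≤ n ↔ G.language = G.boundedLanguage n := by
  have key : ∀ w, G.indWord w ≤ n ↔ w ∈ G.boundedLanguage n := by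
    intro w
    rw [indWord, iInf₂_le_natCast]
    simp only [indDerivation, iSup₂_le_iff]
    have h0 : (ntCount (ofWord G.N w) : ℕ∞) ≤ n := by simp [ntCount_eq]
    constructor
    · rintro ⟨D, ⟨h1, ⟨r₁, h2⟩, r₂, h3⟩, h4⟩
      exact ⟨r₁, r₂, (reflTransGen_bstep_iff.2 ⟨D, h1, h2, h3, h4⟩).1⟩
    · rintro ⟨r₁, r₂, h⟩
      obtain ⟨D, h1, h2, h3, h4⟩ := reflTransGen_bstep_iff.1 ⟨h, h0⟩
      exact ⟨D, ⟨h1, ⟨r₁, h2⟩, r₂, h3⟩, h4⟩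
  simp only [ind, iSup₂_le_iff, key]
  rw [language_eq]
  exact ⟨fun h => le_antisymm h (boundedLanguage_mono le_top), fun h w hw => h ▸ hw⟩

theorem mem_familyOfFiniteIndex {Γ : Type*} {C : Set Γ} {lang : Γ → Language T} {ind : Γ → ℕ∞}
    {L : Language T} : L ∈ familyOfFiniteIndex C lang ind ↔
      ∃ G ∈ C, EqModLambda (lang G) L ∧ ∃ n : ℕ, 1 ≤ n ∧ ind G ≤ n := by
  have key : ∀ n : ℕ, indLanguage C lang ind L ≤ n ↔
      ∃ G, (G ∈ C ∧ EqModLambda (lang G) L) ∧ ind G ≤ n := by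
    intro n
    rw [← iInf₂_le_natCast]
    simp only [indLanguage, iInf_and]
  simp only [familyOfFiniteIndex, familyOfIndex, Set.mem_iUnion, Set.mem_ofPred_eq, key, family]
  constructor
  · rintro ⟨n, hn, -, G, ⟨h1, h2⟩, h3⟩
    exact ⟨G, h1, h2, n, hn, h3⟩
  · rintro ⟨G, h1, h2, n, hn, h3⟩
    exact ⟨n, hn, ⟨G, h1, h2⟩, G, ⟨h1, h2⟩, h3⟩

variable {X : RuleType} {L : Language T}

theorem mem_finCD_iff {f : Mode} : L ∈ finCD T X f ↔ ∃ G ∈ CDSystem.ofType X,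
    EqModLambda (G.language f) L ∧ ∃ n : ℕ, 1 ≤ n ∧ G.language f = G.boundedLanguage n f := by
  simp only [finCD, mem_familyOfFiniteIndex, CDSystem.ind_le_iff]

theorem mem_finP_iff : L ∈ finP T X ↔ ∃ G ∈ ProgrammedGrammar.ofType X,
    EqModLambda G.language L ∧ ∃ n : ℕ, 1 ≤ n ∧ G.language = G.boundedLanguage n := by
  simp only [finP, mem_familyOfFiniteIndex, ProgrammedGrammar.ind_le_iff]

end Index

theorem RuleType.allows_iff {T : Type u} {N : Type} {X : RuleType} {r : ContextFreeRule T N} :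
    X.Allows r ↔ (X = .cfLambdaFree → r.output ≠ []) := by
  cases X <;> simp [RuleType.Allows]

theorem finite_forms {T : Type u} [Finite T] {N : Type} [Finite N] (l : ℕ) :
    {z : Form T N | z.length ≤ l}.Finite := by
  have : Finite (Symbol T N) := by
    refine Finite.of_injective (β := T ⊕ N)
      (fun s => match s with | .terminal a => .inl a | .nonterminal A => .inr A) ?_
    rintro (a | a) (b | b) h <;> simp_all
  exact List.finite_length_le _ _

/-! ### Finite controls and machines -/

/-- A grammar with a finite control: `rel c l r d` says that, in state `c` and with the list `l` of
nonterminals present, rule `r` may be applied, leading to state `d`. -/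
structure Controlled (T : Type u) where
  N : Type
  finiteN : Finite N
  S : N
  C : Type
  finiteC : Finite C
  c₀ : C
  R : Set (ContextFreeRule T N)
  finiteR : R.Finite
  rel : C → List N → ContextFreeRule T N → C → Prop
  accept : C → Prop

namespace Controlled

variable {T : Type u} (K : Controlled T)

/-- A step between forms with at most `n` nonterminal occurrences. -/
def Step (n : ℕ) (a b : Form T K.N × K.C) : Prop :=
  ∃ r ∈ K.R, r.Rewrites a.1 b.1 ∧ K.rel a.2 (nts a.1) r b.2 ∧ ntCount a.1 ≤ n ∧ ntCount b.1 ≤ n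

/-- Reachability through forms with at most `n` nonterminal occurrences. -/
def Reach (n : ℕ) (x : Form T K.N) (c : K.C) : Prop :=
  Relation.ReflTransGen (K.Step n) ([.nonterminal K.S], K.c₀) (x, c)

/-- The words generated with index at most `n`. -/
def language (n : ℕ) : Language T :=
  {w | ∃ c, K.accept c ∧ K.Reach n (ofWord K.N w) c}

end Controlled

/-- A grammar with a finite control in which no nonterminal occurs twice in a reachable form, and
the state determines the list of nonterminals of the form. -/
structure Machine (T : Type u) where
  V : Type
  finiteV : Finite V
  Q : Type
  finiteQ : Finite Q
  Tr : Type
  finiteTr : Finite Tr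
  v₀ : V
  q₀ : Q
  src : Tr → Q
  tgt : Tr → Q
  var : Tr → V
  out : Tr → Form T V
  nm : Q → List V
  bound : ℕ
  nm_q₀ : nm q₀ = [v₀]
  nodup : ∀ q, (nm q).Nodup
  length_le : ∀ q, (nm q).length ≤ bound
  var_mem : ∀ τ, var τ ∈ nm (src τ)
  fresh : ∀ τ, ∀ w ∈ nts (out τ), w ∉ nm (src τ)
  nm_tgt : ∀ τ, nm (tgt τ) = nts (subst (var τ) (out τ) ((nm (src τ)).map .nonterminal))
  var_eq : ∀ τ, var τ = v₀ → src τ = q₀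

/-- Substitution acts on the list of nonterminals. -/
theorem nts_subst {T : Type u} {N : Type} (A : N) (z x : Form T N) :
    nts (subst A z x) = nts (subst A z ((nts x).map .nonterminal)) := by
  induction x using form_induction with
  | nil => rfl
  | nonterminal B x ih => simp_all [subst]
  | terminal a x ih => simp_all [subst]

namespace Machine

variable {T : Type u} (M : Machine T)

/-- Reachable pairs of a form and a state. -/
inductive Reach : Form T M.V → M.Q → Prop
  | start : Reach [.nonterminal M.v₀] M.q₀
  | step {y : Form T M.V} (τ : M.Tr) (h : Reach y (M.src τ)) :
      Reach (subst (M.var τ) (M.out τ) y) (M.tgt τ)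

/-- The generated language. -/
def language : Language T := {w | ∃ q, M.Reach (ofWord M.V w) q}

/-- All rules have the given type. -/
def HasType (X : RuleType) : Prop := ∀ τ, X = .cfLambdaFree → M.out τ ≠ []

variable {M}

theorem Reach.nts_eq {y : Form T M.V} {q : M.Q} (h : M.Reach y q) : nts y = M.nm q := by
  induction h with
  | start => exact M.nm_q₀.symm
  | step τ h ih => rw [nts_subst, M.nm_tgt, ih]

theorem Reach.nodup {y : Form T M.V} {q : M.Q} (h : M.Reach y q) : (nts y).Nodup :=
  h.nts_eq ▸ M.nodup q

end Machine

/-! ### Numbering the nonterminal occurrences of a form -/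

section Naming

variable {T : Type u} {N M : Type}

/-- The renaming of the nonterminals of a form. -/
def rename (π : N → M) (x : Form T N) : Form T M := bindN (fun A => [.nonterminal (π A)]) x

theorem rename_append (π : N → M) (x y : Form T N) :
    rename π (x ++ y) = rename π x ++ rename π y := bindN_append _ _ _

theorem nts_rename (π : N → M) (x : Form T N) : nts (rename π x) = (nts x).map π := by
  simp [rename, nts_bindN, ← List.map_eq_flatMap]

@[simp] theorem rename_ofWord (π : N → M) (w : List T) :
    rename π (ofWord N w) = ofWord M w := bindN_ofWord _ _

theorem rename_eq_map (π : N → M) (x : Form T N) : rename π x = x.map fun s => match s with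
    | .nonterminal A => .nonterminal (π A)
    | .terminal a => .terminal a := by
  induction x using form_induction with
  | nil => rfl
  | nonterminal A x ih => simpa [rename] using ih
  | terminal a x ih => simpa [rename] using ih

theorem rename_eq_split {π : N → M} {x : Form T N} {p q : Form T M} {A : M}
    (h : rename π x = p ++ [.nonterminal A] ++ q) : ∃ p' v q',
      x = p' ++ [.nonterminal v] ++ q' ∧ rename π p' = p ∧ π v = A ∧ rename π q' = q := by
  rw [rename_eq_map, List.map_eq_append_iff] at h
  obtain ⟨x₁, q', rfl, h, hq⟩ := h
  rw [List.map_eq_append_iff] at h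
  obtain ⟨p', s, rfl, hp, h⟩ := h
  rw [List.map_eq_singleton_iff] at h
  obtain ⟨s, rfl, h⟩ := h
  rw [← rename_eq_map] at hp hq
  cases s with
  | terminal a => simp at h
  | nonterminal v => exact ⟨p', v, q', rfl, hp, by simpa using h, hq⟩

/-- A form can be numbered with pairwise distinct numbers outside a given small set. -/
theorem exists_fresh_naming {m : ℕ} (z : Form T N) (used : Finset (Fin m))
    (h : used.card + ntCount z ≤ m) : ∃ z' : Form T (N × Fin m), rename Prod.fst z' = z ∧
      (nts z').Nodup ∧ ∀ v ∈ nts z', v.2 ∉ used := by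
  induction z using form_induction generalizing used with
  | nil => exact ⟨[], rfl, by simp, by simp⟩
  | terminal a x ih =>
    obtain ⟨z', rfl, h2⟩ := ih used (by simpa [ntCount_eq] using h)
    exact ⟨.terminal a :: z', rfl, h2⟩
  | nonterminal A x ih =>
    simp only [ntCount_eq, nts_nonterminal_cons, List.length_cons] at h ih
    obtain ⟨j, hj⟩ : ∃ j, j ∉ used := by
      by_contra! H
      have : used = Finset.univ := by ext; simp [H]
      simp [this] at h
    obtain ⟨z', rfl, h2, h3⟩ := ih (insert j used) (by rw [Finset.card_insert_of_notMem hj]; omega)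
    refine ⟨.nonterminal (A, j) :: z', rfl, ?_, ?_⟩
    · exact List.nodup_cons.2 ⟨fun h => h3 _ h (by simp), h2⟩
    · rintro v hv
      rcases List.mem_cons.1 hv with rfl | hv
      · exact hj
      · exact fun h => h3 v hv (Finset.mem_insert_of_mem h)

theorem nodup_nts_subst {A : N} {z x : Form T N} (hx : (nts x).Nodup) (hz : (nts z).Nodup)
    (hzx : ∀ B ∈ nts z, B ∉ nts x) : (nts (subst A z x)).Nodup := by
  classical
  rw [subst, nts_bindN, List.nodup_flatMap]
  refine ⟨fun B _ => by split_ifs <;> simp [hz], ?_⟩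
  refine hx.imp_of_mem ?_
  intro B C hB hC hne
  simp only [Function.onFun]
  split_ifs with h1 h2 h2
  · exact absurd (h1.trans h2.symm) hne
  · simp only [nts_nonterminal_cons, nts_nil, List.disjoint_singleton]
    exact fun h => hzx _ h hC
  · simp only [nts_nonterminal_cons, nts_nil, List.singleton_disjoint]
    exact fun h => hzx _ h hB
  · simpa using hne.symm

end Naming

/-! ### From finite controls to machines -/

namespace Controlled

variable {T : Type u} (K : Controlled T) (n : ℕ)

/-- Numbered nonterminals. -/
abbrev Name : Type := K.N × Fin (2 * n + 1)

/-- A state together with the list of the numbered nonterminals of the form. -/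
abbrev NamedState : Type := K.C × {l : List (K.Name n) // l.Nodup ∧ l.length ≤ n}

/-- The start symbol with its number. -/
abbrev startName : K.Name n := (K.S, 0)

/-- The initial state. -/
def startState (hn : 1 ≤ n) : K.NamedState n :=
  (K.c₀, ⟨[K.startName n], List.nodup_singleton _, hn⟩)

variable (hn : 1 ≤ n)

/-- The numbered version of a step. -/
structure IsTransition (q : K.NamedState n) (v : K.Name n) (z : Form T (K.Name n))
    (q' : K.NamedState n) : Prop where
  mem : ⟨v.1, rename Prod.fst z⟩ ∈ K.R
  rel : K.rel q.1 (q.2.1.map Prod.fst) ⟨v.1, rename Prod.fst z⟩ q'.1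
  var_mem : v ∈ q.2.1
  fresh : ∀ w ∈ nts z, w ∉ q.2.1
  nm_tgt : q'.2.1 = nts (subst v z (q.2.1.map .nonterminal))
  var_eq : v = K.startName n → q = K.startState n hn
  accept : q'.2.1 = [] → K.accept q'.1

theorem finite_namedState : Finite (K.NamedState n) := by
  have := K.finiteN
  have := K.finiteC
  have : Finite {l : List (K.Name n) // l.Nodup ∧ l.length ≤ n} :=
    ((List.finite_length_le (K.Name n) n).subset fun l h => h.2).to_subtype
  infer_instance

/-- The numbered versions of all steps. -/
abbrev Transition : Type u := {t : K.NamedState n × K.Name n × Form T (K.Name n) × K.NamedState n //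
  K.IsTransition n hn t.1 t.2.1 t.2.2.1 t.2.2.2}

/-- Renaming preserves length and `K.R` is finite, so the forms inserted by transitions have bounded
length; over finite alphabets there are only finitely many of them. -/
theorem finite_transition [Finite T] : Finite (K.Transition n hn) := by
  have := K.finiteN
  have := K.finite_namedState n
  obtain ⟨l, hl⟩ := (K.finiteR.image fun r => r.output.length).bddAbove
  refine Set.Finite.to_subtype (s := {t : K.NamedState n × K.Name n × Form T (K.Name n) ×
    K.NamedState n | K.IsTransition n hn t.1 t.2.1 t.2.2.1 t.2.2.2}) <| (Set.finite_univ.prod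
    (Set.finite_univ.prod ((finite_forms l).prod Set.finite_univ))).subset ?_
  rintro t ht
  refine ⟨trivial, trivial, ?_, trivial⟩
  have := hl ⟨_, ht.mem, rfl⟩
  simpa [rename_eq_map] using this

/-- Reachability by numbered steps. -/
inductive NamedReach : Form T (K.Name n) → K.NamedState n → Prop
  | start : NamedReach [.nonterminal (K.startName n)] (K.startState n hn)
  | step {y z : Form T (K.Name n)} {v : K.Name n} {q q' : K.NamedState n}
      (h : NamedReach y q) (ht : K.IsTransition n hn q v z q') : NamedReach (subst v z y) q'

variable {K n hn}

theorem NamedReach.nts_eq {y : Form T (K.Name n)} {q : K.NamedState n}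
    (h : K.NamedReach n hn y q) : nts y = q.2.1 := by
  induction h with
  | start => rfl
  | step h ht ih => rw [nts_subst, ih, ht.nm_tgt]

theorem NamedReach.nodup {y : Form T (K.Name n)} {q : K.NamedState n}
    (h : K.NamedReach n hn y q) : (nts y).Nodup :=
  h.nts_eq ▸ q.2.2.1

/-- Transitions that leave no nonterminal are admitted only into accepting states, which is why a
machine needs no acceptance condition of its own. -/
theorem NamedReach.reach {y : Form T (K.Name n)} {q : K.NamedState n}
    (h : K.NamedReach n hn y q) :
    K.Reach n (rename Prod.fst y) q.1 ∧ (nts y = [] → K.accept q.1) := by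
  induction h with
  | start => exact ⟨.refl, fun h => by simp at h⟩
  | @step y z v q q' h ht ih =>
    have hy := h.nts_eq
    have hy' := (h.step ht).nts_eq
    refine ⟨ih.1.tail ⟨_, ht.mem, ?_, ?_, ?_, ?_⟩, fun h0 => ht.accept (hy'.symm.trans h0)⟩
    · obtain ⟨p, s, rfl⟩ := exists_split (hy ▸ ht.var_mem)
      obtain ⟨hp, hs⟩ := notMem_of_nodup_split h.nodup
      rw [subst_split hp hs]
      simp only [rename_append]
      exact ContextFreeRule.rewrites_of_exists_parts _ _ _
    · simp only [nts_rename, hy]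
      exact ht.rel
    · simp only [ntCount_eq, nts_rename, List.length_map, hy]
      exact q.2.2.2
    · simp only [ntCount_eq, nts_rename, List.length_map, hy']
      exact q'.2.2.2

/-- Lifts a derivation step by step, choosing fresh numbers for the inserted nonterminals. The last
clause of the conclusion is the invariant that supplies `IsTransition.var_eq`. -/
theorem exists_namedReach {a : Form T K.N × K.C}
    (h : Relation.ReflTransGen (K.Step n) ([.nonterminal K.S], K.c₀) a)
    (ha : nts a.1 = [] → K.accept a.2) :
    ∃ (y : Form T (K.Name n)) (q : K.NamedState n), K.NamedReach n hn y q ∧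
      rename Prod.fst y = a.1 ∧ q.1 = a.2 ∧
      (K.startName n ∈ nts y → q = K.startState n hn) := by
  classical
  induction h with
  | refl => exact ⟨_, _, .start, rfl, rfl, fun _ => rfl⟩
  | @tail a b h hs ih =>
    obtain ⟨r, hr, hrw, hrel, hna, hnb⟩ := hs
    -- A form that is rewritten further contains a nonterminal, so for it the acceptance hypothesis
    -- is vacuous.
    obtain ⟨y, q, hy, hya, hqa, hq₀⟩ := ih fun h0 => by
      have := Rewrites.input_mem hrw
      simp [h0] at this
    obtain ⟨p, s, hp, hs⟩ := hrw.exists_parts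
    rw [hp] at hya
    obtain ⟨p', v, s', rfl, hp', hv, hs'⟩ := rename_eq_split hya
    obtain ⟨hvp, hvs⟩ := notMem_of_nodup_split hy.nodup
    have hyq := hy.nts_eq
    -- At most `n` numbers are in use, `0` is reserved for the start name, and at most `n` new ones
    -- are needed: `2 * n + 1` suffice.
    obtain ⟨z, hz, hznd, hzf⟩ := exists_fresh_naming (m := 2 * n + 1) r.output
      (insert 0 (q.2.1.map Prod.snd).toFinset) (by
        have h1 := Finset.card_insert_le (0 : Fin (2 * n + 1)) (q.2.1.map Prod.snd).toFinset
        have h2 := List.toFinset_card_le (q.2.1.map Prod.snd)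
        have h3 := q.2.2.2
        have h4 : ntCount r.output ≤ ntCount b.1 := by
          simp only [ntCount_eq, hs, nts_append, List.length_append]
          omega
        simp only [List.length_map] at h2
        omega)
    have hfresh : ∀ w ∈ nts z, w ∉ q.2.1 := fun w hw hw' => hzf w hw
      (Finset.mem_insert_of_mem (by simpa using ⟨w.1, hw'⟩))
    have hr' : (⟨v.1, rename Prod.fst z⟩ : ContextFreeRule T K.N) = r := by
      rw [hz, hv]
    set y' := subst v z (p' ++ [.nonterminal v] ++ s') with hy'
    have hy'' : y' = p' ++ z ++ s' := subst_split hvp hvs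
    have hyb : rename Prod.fst y' = b.1 := by
      rw [hy'', rename_append, rename_append, hp', hs', hz, hs]
    have hlen : (nts y').length ≤ n := by
      rw [← hyb, ntCount_eq, nts_rename, List.length_map] at hnb
      exact hnb
    have hnd : (nts y').Nodup := nodup_nts_subst hy.nodup hznd (hyq ▸ hfresh)
    have ht : K.IsTransition n hn q v z (b.2, ⟨nts y', hnd, hlen⟩) :=
      { mem := hr'.symm ▸ hr
        rel := by
          simp only [hr', hqa, ← hyq, ← nts_rename, hya, ← hp]
          exact hrel
        var_mem := by simp [← hyq]
        fresh := hfresh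
        nm_tgt := by simp only [hy', ← hyq]; exact nts_subst _ _ _
        var_eq := fun h => hq₀ (by simp [h])
        accept := fun h0 => ha (by
          simp only at h0
          rw [← hyb, nts_rename, h0, List.map_nil]) }
    refine ⟨y', _, hy.step ht, hyb, rfl, fun h0 => ?_⟩
    -- After a step the start name is gone for good. It is not among the new names, whose numbers
    -- are nonzero; had it survived from before, the old state would be the initial one, whose only
    -- name is the one just replaced.
    exfalso
    have h5 : K.startName n ∉ nts z := fun h => hzf _ h (Finset.mem_insert_self _ _)
    rw [hy'', nts_append, nts_append, List.mem_append, List.mem_append] at h0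
    have h6 : K.startName n ∈ nts p' ∨ K.startName n ∈ nts s' :=
      h0.elim (fun h => h.elim .inl fun h => absurd h h5) .inr
    have h7 : nts (p' ++ [.nonterminal v] ++ s') = [K.startName n] := by
      rw [hyq, hq₀ (by
        rw [nts_append, nts_append, List.mem_append, List.mem_append]
        exact h6.elim (fun h => .inl (.inl h)) .inr)]
      rfl
    have h8 : v = K.startName n := by
      have : v ∈ nts (p' ++ [.nonterminal v] ++ s') := by simp
      rw [h7] at this
      simpa using this
    rw [← h8] at h6
    exact h6.elim hvp hvs

variable (K n hn)

/-- The machine that simulates the derivations of index at most `n`. -/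
noncomputable def toMachine [Finite T] : Machine T :=
  have := K.finite_transition n hn
  -- Transitions contain forms over `T` and live in `Type u`; counting them brings them down to
  -- `Type`.
  let e := (Finite.equivFin (K.Transition n hn)).symm
  { V := K.Name n
    finiteV := have := K.finiteN; inferInstance
    Q := K.NamedState n
    finiteQ := K.finite_namedState n
    Tr := Fin (Nat.card (K.Transition n hn))
    finiteTr := inferInstance
    v₀ := K.startName n
    q₀ := K.startState n hn
    src := fun τ => (e τ).1.1
    tgt := fun τ => (e τ).1.2.2.2
    var := fun τ => (e τ).1.2.1
    out := fun τ => (e τ).1.2.2.1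
    nm := fun q => q.2.1
    bound := n
    nm_q₀ := rfl
    nodup := fun q => q.2.2.1
    length_le := fun q => q.2.2.2
    var_mem := fun τ => (e τ).2.var_mem
    fresh := fun τ => (e τ).2.fresh
    nm_tgt := fun τ => (e τ).2.nm_tgt
    var_eq := fun τ => (e τ).2.var_eq }

theorem toMachine_isTransition [Finite T] (τ : (K.toMachine n hn).Tr) :
    K.IsTransition n hn ((K.toMachine n hn).src τ) ((K.toMachine n hn).var τ)
      ((K.toMachine n hn).out τ) ((K.toMachine n hn).tgt τ) :=
  have := K.finite_transition n hn
  ((Finite.equivFin (K.Transition n hn)).symm τ).2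

theorem toMachine_hasType [Finite T] {X : RuleType} (hX : ∀ r ∈ K.R, X.Allows r) :
    (K.toMachine n hn).HasType X := by
  intro τ h h'
  have h2 := RuleType.allows_iff.1 (hX _ (K.toMachine_isTransition n hn τ).mem) h
  refine h2 ?_
  simp only [h']
  rfl

theorem toMachine_reach_iff [Finite T] {y : Form T (K.Name n)} {q : K.NamedState n} :
    (K.toMachine n hn).Reach y q ↔ K.NamedReach n hn y q := by
  have := K.finite_transition n hn
  let e := (Finite.equivFin (K.Transition n hn)).symm
  constructor
  · intro h
    refine Machine.Reach.rec (motive := fun y q _ => K.NamedReach n hn y q) .start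
      (fun τ _ ih => ih.step (K.toMachine_isTransition n hn τ)) h
  · intro h
    induction h with
    | start => exact .start
    | @step y z v q q' h ht ih =>
      have key : ∀ t : K.Transition n hn, (K.toMachine n hn).Reach y t.1.1 →
          (K.toMachine n hn).Reach (subst t.1.2.1 t.1.2.2.1 y) t.1.2.2.2 := by
        intro t
        obtain ⟨τ, rfl⟩ := e.surjective t
        exact Machine.Reach.step (M := K.toMachine n hn) τ
      exact key ⟨(q, v, z, q'), ht⟩ ih

theorem toMachine_language [Finite T] : (K.toMachine n hn).language = K.language n := by
  ext w
  trans ∃ q, K.NamedReach n hn (ofWord _ w) q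
  · exact exists_congr fun q => K.toMachine_reach_iff n hn
  constructor
  · rintro ⟨q, h⟩
    obtain ⟨h1, h2⟩ := h.reach
    rw [rename_ofWord] at h1
    exact ⟨q.1, h2 (nts_ofWord w), h1⟩
  · rintro ⟨c, hc, h⟩
    obtain ⟨y, q, hy, hyw, -⟩ := exists_namedReach (hn := hn) h fun _ => hc
    have h0 : nts y = [] := by
      have := nts_rename Prod.fst y
      rw [hyw, nts_ofWord] at this
      simpa using this.symm
    obtain ⟨w', rfl⟩ := nts_eq_nil.1 h0
    rw [rename_ofWord] at hyw
    exact ⟨q, ofWord_injective hyw ▸ hy⟩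

end Controlled

theorem singleton_ne_ofWord {T : Type u} {N : Type} {A : N} {w : List T} :
    ofWord N w ≠ [.nonterminal A] := fun h => by
  have := congrArg nts h
  simp at this

/-! ### Programmed grammars and machines -/

namespace ProgrammedGrammar

variable {T : Type u} (G : ProgrammedGrammar T)

/-- A programmed grammar as a grammar with a finite control. -/
def toControlled : Controlled T where
  N := G.N
  finiteN := G.finiteN
  S := G.S
  -- The state `none` means that the first label, which is arbitrary, has not been chosen yet.
  C := Option G.Label
  finiteC := have := G.finiteLabel; inferInstance
  c₀ := none
  R := G.P
  finiteR := G.P.finite_toSet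
  rel c _ r d := ∃ r₁ r₂, (c = some r₁ ∨ c = none) ∧ d = some r₂ ∧ r = G.rule r₁ ∧ r₂ ∈ G.σ r₁
  accept _ := True

variable {G} {n : ℕ}

theorem toControlled_language (hφ : ∀ r, G.φ r = ∅) :
    G.toControlled.language n = G.boundedLanguage n := by
  ext w
  constructor
  · rintro ⟨c, -, h⟩
    have key : ∀ a, Relation.ReflTransGen (G.toControlled.Step n) ([.nonterminal G.S], none) a →
        a = ([.nonterminal G.S], none) ∨ ∃ r r₁, a.2 = some r ∧
          Relation.ReflTransGen (G.BStep n) ([.nonterminal G.S], r₁) (a.1, r) := by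
      intro a h
      induction h with
      | refl => exact .inl rfl
      | @tail a b h hs ih =>
        obtain ⟨r, hr, hrw, ⟨r₁, r₂, h1, h2, rfl, h3⟩, hna, hnb⟩ := hs
        refine .inr ?_
        have hstep : G.BStep n (a.1, r₁) (b.1, r₂) :=
          ⟨.inl ⟨hrw, h3⟩, by exact_mod_cast hna, by exact_mod_cast hnb⟩
        rcases ih with rfl | ⟨r, r₀, h4, h5⟩
        · exact ⟨r₂, r₁, h2, .single hstep⟩
        · rcases h1 with h1 | h1
          · obtain rfl : r = r₁ := Option.some.inj (h4.symm.trans h1)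
            exact ⟨r₂, r₀, h2, h5.tail hstep⟩
          · simp [h1] at h4
    rcases key _ h with h | ⟨r, r₁, -, h⟩
    · exact absurd (congrArg Prod.fst h) singleton_ne_ofWord
    · exact ⟨r₁, r, h⟩
  · rintro ⟨r₁, r₂, h⟩
    have key : ∀ a, Relation.ReflTransGen (G.BStep n) ([.nonterminal G.S], r₁) a →
        a = ([.nonterminal G.S], r₁) ∨ G.toControlled.Reach n a.1 (some a.2) := by
      intro a h
      induction h with
      | refl => exact .inl rfl
      | @tail a b h hs ih =>
        obtain ⟨hs | hs, hna, hnb⟩ := hs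
        · refine .inr ?_
          rcases ih with rfl | ih
          · exact .single ⟨G.rule r₁, G.rule_mem r₁, hs.1, ⟨_, _, .inr rfl, rfl, rfl, hs.2⟩,
              by exact_mod_cast hna, by exact_mod_cast hnb⟩
          · exact ih.tail ⟨G.rule a.2, G.rule_mem _, hs.1, ⟨_, _, .inl rfl, rfl, rfl, hs.2⟩,
              by exact_mod_cast hna, by exact_mod_cast hnb⟩
        · simp [hφ] at hs
    rcases key _ h with h | h
    · exact absurd (congrArg Prod.fst h) singleton_ne_ofWord
    · exact ⟨_, trivial, h⟩

end ProgrammedGrammar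

theorem notMem_nts_subst {T : Type u} {N : Type} {A : N} {z x : Form T N} (h : A ∉ nts z) :
    A ∉ nts (subst A z x) := by
  rw [subst, mem_nts_bindN]
  rintro ⟨B, -, hB⟩
  split_ifs at hB with hBA
  · exact h hB
  · simp at hB
    exact hBA hB.symm

namespace Machine

variable {T : Type u} (M : Machine T)

/-- The rule of a transition. -/
def rule (τ : M.Tr) : ContextFreeRule T M.V := ⟨M.var τ, M.out τ⟩

theorem finite_range_rule : (Set.range M.rule).Finite :=
  have := M.finiteTr
  Set.finite_range _

/-- A machine as a programmed grammar whose labels are the transitions. -/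
noncomputable def toProgrammed : ProgrammedGrammar T where
  N := M.V
  finiteN := M.finiteV
  S := M.v₀
  P := M.finite_range_rule.toFinset
  Label := M.Tr
  finiteLabel := M.finiteTr
  rule := M.rule
  rule_mem r := by simp
  -- The label `τ` itself is added so that the last step of a derivation always has a successor
  -- label. It does no harm: `M.var τ` is absent after the step, so `τ` is not applicable again.
  σ τ := {τ' | M.src τ' = M.tgt τ ∨ τ' = τ}
  φ _ := ∅

variable {M}

theorem var_notMem_out (τ : M.Tr) : M.var τ ∉ nts (M.out τ) :=
  fun h => M.fresh τ _ h (M.var_mem τ)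

theorem Reach.ntCount_le {y : Form T M.V} {q : M.Q} (h : M.Reach y q) : ntCount y ≤ M.bound := by
  rw [ntCount_eq, h.nts_eq]
  exact M.length_le q

theorem toProgrammed_sound (w : List T) (h : w ∈ M.toProgrammed.language) : w ∈ M.language := by
  obtain ⟨r₁, r₂, h⟩ := h
  have key : ∀ a, Relation.ReflTransGen M.toProgrammed.Step ([.nonterminal M.v₀], r₁) a →
      ∃ q, M.Reach a.1 q ∧ (M.src a.2 = q ∨ (a.1 = [.nonterminal M.v₀] ∧ q = M.q₀) ∨
        M.var a.2 ∉ nts a.1) := by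
    intro a h
    induction h with
    | refl => exact ⟨_, .start, .inr (.inl ⟨rfl, rfl⟩)⟩
    | @tail a b h hs ih =>
      obtain ⟨q, hq, ih⟩ := ih
      rcases hs with ⟨hrw, hσ⟩ | ⟨-, -, hφ⟩
      · obtain ⟨hv, hb⟩ := (rewrites_iff_of_nodup hq.nodup _).1 hrw
        have hv : M.var a.2 ∈ nts a.1 := hv
        have hsrc : M.src a.2 = q := by
          -- The label can disagree with the state in two ways. An arbitrary first label that
          -- applies to the start form belongs to the initial state by `M.var_eq`; a label repeated
          -- through its own success field is not applicable.
          rcases ih with ih | ⟨h1, rfl⟩ | ih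
          · exact ih
          · rw [h1] at hv
            exact M.var_eq _ (List.mem_singleton.1 hv)
          · exact absurd hv ih
        subst hsrc
        refine ⟨_, hb ▸ hq.step a.2, ?_⟩
        rcases hσ with hσ | hσ
        · exact .inl hσ
        · refine .inr (.inr ?_)
          rw [hσ, hb]
          exact notMem_nts_subst (var_notMem_out a.2)
      · exact absurd hφ (Set.notMem_empty _)
  obtain ⟨q, hq, -⟩ := key _ h
  exact ⟨q, hq⟩

theorem toProgrammed_complete (w : List T) (h : w ∈ M.language) :
    w ∈ M.toProgrammed.boundedLanguage M.bound := by
  obtain ⟨q, h⟩ := h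
  have key : ∀ y q, M.Reach y q → (y = [.nonterminal M.v₀] ∧ q = M.q₀) ∨ ∃ r₁ τ, M.tgt τ = q ∧
      ∀ τ' ∈ M.toProgrammed.σ τ, Relation.ReflTransGen (M.toProgrammed.BStep M.bound)
        ([.nonterminal M.v₀], r₁) (y, τ') := by
    intro y q h
    induction h with
    | start => exact .inl ⟨rfl, rfl⟩
    | @step y τ h ih =>
      refine .inr ?_
      have hstep : ∀ τ' ∈ M.toProgrammed.σ τ, M.toProgrammed.BStep M.bound (y, τ)
          (subst (M.var τ) (M.out τ) y, τ') := by
        intro τ' hτ'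
        refine ⟨.inl ⟨(rewrites_iff_of_nodup h.nodup (M.rule τ)).2 ⟨?_, rfl⟩, hτ'⟩, ?_, ?_⟩
        · exact h.nts_eq ▸ M.var_mem τ
        · exact_mod_cast h.ntCount_le
        · exact_mod_cast (h.step τ).ntCount_le
      rcases ih with ⟨rfl, -⟩ | ⟨r₁, τ₁, h1, h2⟩
      · exact ⟨τ, τ, rfl, fun τ' hτ' => .single (hstep τ' hτ')⟩
      · exact ⟨r₁, τ, rfl, fun τ' hτ' => (h2 τ (.inl h1.symm)).tail (hstep τ' hτ')⟩
  rcases key _ _ h with h | ⟨r₁, τ, -, h⟩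
  · exact absurd h.1 singleton_ne_ofWord
  · exact ⟨r₁, τ, h τ (.inr rfl)⟩

end Machine

/-! ### Machines describe the programmed languages of finite index -/

section FinP

variable {T : Type u} {X : RuleType} {L : Language T}

theorem mem_finP_of_machine {M : Machine T} (hX : M.HasType X) (hL : EqModLambda M.language L) :
    L ∈ finP T X := by
  have h1 : M.toProgrammed.language ≤ M.language := M.toProgrammed_sound
  have h2 : M.language ≤ M.toProgrammed.boundedLanguage M.bound := M.toProgrammed_complete
  -- The family of finite index asks for a positive bound, hence the `+ 1`.
  have h3 : M.toProgrammed.boundedLanguage M.bound ≤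
      M.toProgrammed.boundedLanguage (M.bound + 1 : ℕ) :=
    ProgrammedGrammar.boundedLanguage_mono (by exact_mod_cast Nat.le_succ _)
  have h4 : M.toProgrammed.boundedLanguage (M.bound + 1 : ℕ) ≤ M.toProgrammed.language := by
    rw [ProgrammedGrammar.language_eq]
    exact ProgrammedGrammar.boundedLanguage_mono le_top
  refine mem_finP_iff.2 ⟨M.toProgrammed, ⟨fun r hr => ?_, fun _ => rfl⟩, ?_, M.bound + 1,
    Nat.le_add_left _ _, le_antisymm (h1.trans (h2.trans h3)) h4⟩
  · obtain ⟨τ, rfl⟩ := M.finite_range_rule.mem_toFinset.1 hr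
    exact RuleType.allows_iff.2 (hX τ)
  · rwa [le_antisymm h1 (h2.trans (h3.trans h4))]

theorem exists_machine_of_mem_finP [Finite T] (h : L ∈ finP T X) :
    ∃ M : Machine T, M.HasType X ∧ EqModLambda M.language L := by
  obtain ⟨G, hG, hL, n, hn, h⟩ := mem_finP_iff.1 h
  refine ⟨G.toControlled.toMachine n hn, Controlled.toMachine_hasType _ _ _ hG.1, ?_⟩
  rwa [Controlled.toMachine_language, ProgrammedGrammar.toControlled_language hG.2, ← h]

end FinP

/-! ### From CD grammar systems to machines -/

/-- A number beyond which a mode does not distinguish numbers of steps. -/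
def Mode.cap : Mode → ℕ
  | .star => 0
  | .t => 0
  | .le k => k + 1
  | .eq k => k + 1
  | .ge k => k
  | .and f₁ f₂ => max f₁.cap f₂.cap

/-- For `≤ k` and `= k` the cap is `k + 1`, so that having exceeded `k` remains visible; for `≥ k`
the cap `k` is enough. -/
theorem modeOK_min {T : Type u} {N : Type} {R : Set (ContextFreeRule T N)} {f : Mode} {c m : ℕ}
    {y : Form T N} (hc : f.cap ≤ c) : ModeOK R f (min m c) y ↔ ModeOK R f m y := by
  induction f with
  | star => exact Iff.rfl
  | t => exact Iff.rfl
  | le k => simp only [ModeOK, Mode.cap] at *; omega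
  | eq k => simp only [ModeOK, Mode.cap] at *; omega
  | ge k => simp only [ModeOK, Mode.cap] at *; omega
  | and f₁ f₂ h₁ h₂ =>
    exact and_congr (h₁ ((le_max_left _ _).trans hc)) (h₂ ((le_max_right _ _).trans hc))

theorem modeOK_congr {T : Type u} {N : Type} {R : Set (ContextFreeRule T N)} {f : Mode} {m : ℕ}
    {y y' : Form T N} (h : nts y = nts y') : ModeOK R f m y ↔ ModeOK R f m y' := by
  induction f with
  | t => simp only [ModeOK, exists_rstep_iff, h]
  | and f₁ f₂ h₁ h₂ => exact and_congr h₁ h₂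
  | _ => exact Iff.rfl

theorem nts_map_nonterminal {T : Type u} {N : Type} (l : List N) :
    nts (l.map (.nonterminal : N → Symbol T N)) = l := by
  induction l with
  | nil => rfl
  | cons a l ih => simpa using ih

namespace CDSystem

variable {T : Type u} (G : CDSystem T) (f : Mode)

/-- A number of steps, capped. -/
def capped (m : ℕ) : Fin (f.cap + 1) := ⟨min m f.cap, Nat.lt_succ_of_le (min_le_right _ _)⟩

theorem capped_add_one (m : ℕ) : capped f ((capped f m : ℕ) + 1) = capped f (m + 1) := by
  ext
  simp only [capped]
  omega

/-- A CD grammar system as a grammar with a finite control, which records the active component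
and the number of steps of the current block. -/
def toControlled : Controlled T where
  N := G.N
  finiteN := G.finiteN
  S := G.S
  C := Option (Fin G.degree × Fin (f.cap + 1))
  finiteC := inferInstance
  c₀ := none
  R := ⋃ i, G.P i
  finiteR := Set.finite_iUnion fun i => (G.P i).finite_toSet
  -- Either the previous block, if any, is closed by testing its mode on the present nonterminals
  -- and component `i` starts a new block with this step, or component `i` continues its block.
  rel c l r d := ∃ i, r ∈ G.P i ∧
    (((c = none ∨ ∃ j m, c = some (j, m) ∧
        ModeOK (G.P j : Set (ContextFreeRule T G.N)) f m (l.map .nonterminal)) ∧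
      d = some (i, capped f 1)) ∨ ∃ m, c = some (i, m) ∧ d = some (i, capped f (m + 1)))
  accept c := ∃ j m, c = some (j, m) ∧ ModeOK (G.P j : Set (ContextFreeRule T G.N)) f m []

variable {G f} {n : ℕ}

theorem toControlled_reach {a : Form T G.N × Option (Fin G.degree × Fin (f.cap + 1))}
    (h : Relation.ReflTransGen ((G.toControlled f).Step n) ([.nonterminal G.S], none) a) :
    a = ([.nonterminal G.S], none) ∨ ∃ i m x, a.2 = some (i, capped f m) ∧
      Relation.ReflTransGen (G.BStep n f) [.nonterminal G.S] x ∧ Run (G.P i : Set _) n m x a.1 := by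
  induction h with
  | refl => exact .inl rfl
  | @tail a b h hs ih =>
    obtain ⟨r, hr, hrw, ⟨i, hri, hrel⟩, hna, hnb⟩ := hs
    refine .inr ?_
    have hna : (ntCount a.1 : ℕ∞) ≤ n := by exact_mod_cast hna
    have hnb : (ntCount b.1 : ℕ∞) ≤ n := by exact_mod_cast hnb
    have hstep : RStep (G.P i : Set _) a.1 b.1 := ⟨r, hri, hrw⟩
    rcases hrel with ⟨hc, hd⟩ | ⟨m, hc, hd⟩
    · refine ⟨i, 1, a.1, hd, ?_, .tail (.refl hna) hstep hnb⟩
      rcases ih with rfl | ⟨j, m, x, h1, h2, h3⟩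
      · exact .refl
      · refine h2.tail ⟨j, m, h3, ?_⟩
        rcases hc with hc | ⟨j', m', hc, hm⟩
        · simp [hc] at h1
        · rw [h1] at hc
          obtain ⟨rfl, rfl⟩ : j = j' ∧ capped f m = m' := by simpa using hc
          exact (modeOK_min le_rfl).1 ((modeOK_congr (nts_map_nonterminal _)).1 hm)
    · rcases ih with rfl | ⟨j, m', x, h1, h2, h3⟩
      · simp at hc
      · rw [h1] at hc
        obtain ⟨rfl, rfl⟩ : j = i ∧ capped f m' = m := by simpa using hc
        exact ⟨j, m' + 1, x, by rw [hd, capped_add_one], h2, .tail h3 hstep hnb⟩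

theorem toControlled_reach_of_bstep {x y : Form T G.N} {c : (G.toControlled f).C}
    (hx : (G.toControlled f).Reach n x c)
    (hc : c = none ∨ ∃ j m, c = some (j, m) ∧ ModeOK (G.P j : Set _) f m x)
    (h : G.BStep n f x y) : ∃ c, (G.toControlled f).Reach n y c ∧
      (c = none ∨ ∃ j m, c = some (j, m) ∧ ModeOK (G.P j : Set _) f m y) := by
  obtain ⟨i, m, h, hm⟩ := h
  -- Blocks of zero steps leave the form unchanged and have no counterpart in the control, so they
  -- are dropped.
  have key : ∀ {m y}, Run (G.P i : Set _) n m x y → (m = 0 ∧ y = x) ∨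
      (G.toControlled f).Reach n y (some (i, capped f m)) := by
    intro m y h
    induction h with
    | refl h => exact .inl ⟨rfl, rfl⟩
    | @tail m x y z hxy hs hz ih =>
      refine .inr ?_
      obtain ⟨r, hr, hs⟩ := hs
      have hz : ntCount z ≤ n := by exact_mod_cast hz
      have hrR : r ∈ (G.toControlled f).R := Set.mem_iUnion.2 ⟨i, hr⟩
      have hy : ntCount y ≤ n := by exact_mod_cast hxy.le_right
      rcases ih hx hc (by assumption) with ⟨rfl, rfl⟩ | ih
      · refine hx.tail ⟨r, hrR, hs, ⟨i, hr, .inl ⟨?_, rfl⟩⟩, hy, hz⟩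
        rcases hc with hc | ⟨j, m, hc, hm⟩
        · exact .inl hc
        · exact .inr ⟨j, m, hc, (modeOK_congr (nts_map_nonterminal _)).2 hm⟩
      · exact ih.tail ⟨r, hrR, hs, ⟨i, hr, .inr ⟨_, rfl, by rw [capped_add_one]⟩⟩, hy, hz⟩
  rcases key h with ⟨rfl, rfl⟩ | h
  · exact ⟨c, hx, hc⟩
  · exact ⟨_, h, .inr ⟨i, _, rfl, (modeOK_min le_rfl).2 hm⟩⟩

theorem toControlled_language : (G.toControlled f).language n = G.boundedLanguage n f := by
  ext w
  constructor
  · rintro ⟨c, ⟨i, m, rfl, hm⟩, h⟩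
    rcases toControlled_reach h with h | ⟨i', m', x, h1, h2, h3⟩
    · exact absurd (congrArg Prod.fst h) singleton_ne_ofWord
    · obtain ⟨rfl, rfl⟩ : i = i' ∧ m = capped f m' := by simpa using h1
      refine Relation.TransGen.tail' h2 ⟨i, m', h3, (modeOK_min le_rfl).1 ?_⟩
      exact (modeOK_congr (by simp)).1 hm
  · intro h
    have key : ∀ y, Relation.TransGen (G.BStep n f) [.nonterminal G.S] y →
        ∃ c, (G.toControlled f).Reach n y c ∧
          (c = none ∨ ∃ j m, c = some (j, m) ∧ ModeOK (G.P j : Set _) f m y) := by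
      intro y h
      induction h with
      | single h => exact toControlled_reach_of_bstep .refl (.inl rfl) h
      | tail _ h ih =>
        obtain ⟨c, h1, h2⟩ := ih
        exact toControlled_reach_of_bstep h1 h2 h
    obtain ⟨c, h1, h2⟩ := key _ h
    refine ⟨c, ?_, h1⟩
    rcases h2 with rfl | ⟨j, m, rfl, hm⟩
    · rcases toControlled_reach h1 with h | ⟨_, _, _, h, _⟩
      · exact absurd (congrArg Prod.fst h) singleton_ne_ofWord
      · simp at h
    · exact ⟨j, m, rfl, (modeOK_congr (by simp)).1 hm⟩

end CDSystem

theorem finCD_subset_finP {T : Type u} [Finite T] {X : RuleType} {f : Mode} :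
    finCD T X f ⊆ finP T X := by
  intro L h
  obtain ⟨G, hG, hL, n, hn, h⟩ := mem_finCD_iff.1 h
  refine mem_finP_of_machine (M := (G.toControlled f).toMachine n hn)
    (Controlled.toMachine_hasType _ _ _ fun r hr => ?_) ?_
  · obtain ⟨i, hi⟩ := Set.mem_iUnion.1 hr
    exact hG i r hi
  · rwa [Controlled.toMachine_language, CDSystem.toControlled_language, ← h]

variable {T : Type u} {X : RuleType} {L : Language T} {f : Mode}

theorem mem_finCD_of_le {G : CDSystem T} (hG : G ∈ CDSystem.ofType X)
    (hL : EqModLambda (G.language f) L) {n : ℕ} (h : G.language f ≤ G.boundedLanguage n f) :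
    L ∈ finCD T X f := by
  refine mem_finCD_iff.2 ⟨G, hG, hL, n + 1, Nat.le_add_left _ _, le_antisymm
    (h.trans (CDSystem.boundedLanguage_mono (by exact_mod_cast Nat.le_succ n))) ?_⟩
  rw [CDSystem.language_eq]
  exact CDSystem.boundedLanguage_mono le_top

theorem finCD_subset_allCD : finCD T X f ⊆ allCD T X f := fun _ h =>
  let ⟨G, hG, hL, _⟩ := mem_finCD_iff.1 h
  ⟨G, hG, hL⟩

/-! ### Finite index from short blocks -/

namespace CDSystem

variable (G : CDSystem T)

/-- A block of at most `k` steps that starts in a form with at most `c` nonterminal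
occurrences. -/
def ShortBlock (c k : ℕ) (f : Mode) (x y : Form T G.N) : Prop :=
  ntCount x ≤ c ∧ ∃ i, ∃ m ≤ k, Run (G.P i : Set _) ⊤ m x y ∧ ModeOK (G.P i : Set _) f m y

/-- Derivations by short blocks have bounded index. -/
theorem exists_bound_of_shortBlock (c k : ℕ) (f : Mode) : ∃ n : ℕ, ∀ w : List T,
    Relation.TransGen (G.ShortBlock c k f) [.nonterminal G.S] (ofWord G.N w) →
      w ∈ G.boundedLanguage n f := by
  have hfin : (⋃ i, (G.P i : Set (ContextFreeRule T G.N))).Finite :=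
    Set.finite_iUnion fun i => (G.P i).finite_toSet
  obtain ⟨l, hl⟩ := (hfin.image fun r => r.output.length).bddAbove
  refine ⟨c + k * l, fun w h => ?_⟩
  refine Relation.TransGen.mono (r := G.ShortBlock c k f) ?_ _ _ h
  rintro x y ⟨hx, i, m, hm, h, hf⟩
  refine ⟨i, m, (Run.bounded (l := l) (fun r hr => hl ⟨r, Set.mem_iUnion.2 ⟨i, hr⟩, rfl⟩) h
    hx).1.mono ?_, hf⟩
  gcongr

end CDSystem

section Counting

variable {N : Type} [DecidableEq N] {R : Set (ContextFreeRule T N)} {x y : Form T N} {m : ℕ}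

theorem Run.count_le (A : N) (h : Run R ⊤ m x y) : (nts x).count A ≤ (nts y).count A + m := by
  induction h with
  | refl _ => simp
  | tail _ hs _ ih =>
    obtain ⟨r, -, hs⟩ := hs
    obtain ⟨p, q, rfl, rfl⟩ := hs.exists_parts
    simp only [nts_append, List.count_append, nts_nonterminal_cons, nts_nil,
      List.count_cons, List.count_nil] at *
    split_ifs at * <;> omega

theorem Run.count_le_of_notMem {A : N} (hA : ∀ r ∈ R, r.input ≠ A) (h : Run R ⊤ m x y) :
    (nts x).count A ≤ (nts y).count A := by
  induction h with
  | refl _ => simp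
  | tail _ hs _ ih =>
    obtain ⟨r, hr, hs⟩ := hs
    obtain ⟨p, q, rfl, rfl⟩ := hs.exists_parts
    simp only [nts_append, List.count_append, nts_nonterminal_cons, nts_nil,
      List.count_cons, List.count_nil] at *
    simp only [beq_iff_eq, hA r hr, if_false] at *
    omega

theorem length_le_of_count_le [Fintype N] {l : List N} {k : ℕ} (h : ∀ A, l.count A ≤ k) :
    l.length ≤ k * Fintype.card N := by
  rw [← List.sum_toFinset_count_eq_length]
  calc ∑ a ∈ l.toFinset, l.count a ≤ ∑ a ∈ l.toFinset, k := Finset.sum_le_sum fun a _ => h a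
    _ = l.toFinset.card * k := by simp
    _ ≤ k * Fintype.card N := by
      rw [mul_comm]
      exact Nat.mul_le_mul_left _ (Finset.card_le_univ _)

end Counting

/-- If every block terminates after at most `k` steps, then the index is finite. -/
theorem allCD_subset_finCD {k : ℕ} (hf : ∀ {N : Type} {R : Set (ContextFreeRule T N)} {m : ℕ}
    {y : Form T N}, ModeOK R f m y → m ≤ k ∧ ¬ ∃ z, RStep R y z) :
    allCD T X f ⊆ finCD T X f := by
  classical
  rintro L ⟨G, hG, hL⟩
  have := G.finiteN
  have := Fintype.ofFinite G.N
  -- Induction backwards from the terminal word. If the component of the block rewrites `A`, the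
  -- block ends without `A` and removed at most one copy per step, so there were at most `k`.
  -- Otherwise no copy disappears, and the bound at the end of the block applies.
  have hcount : ∀ (w : List T) (x : Form T G.N),
      Relation.ReflTransGen (G.BStep ⊤ f) x (ofWord G.N w) → ∀ A, (nts x).count A ≤ k := by
    intro w x h A
    induction h using Relation.ReflTransGen.head_induction_on with
    | refl => simp
    | head h _ ih =>
      obtain ⟨i, m, h, hm⟩ := h
      obtain ⟨hmk, hz⟩ := hf hm
      by_cases hA : ∃ r ∈ (G.P i : Set (ContextFreeRule T G.N)), r.input = A
      · obtain ⟨r, hr, rfl⟩ := hA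
        have h1 := h.count_le r.input
        have h2 := fun hmem => hz (exists_rstep_iff.2 ⟨r, hr, hmem⟩)
        rw [List.count_eq_zero_of_not_mem h2] at h1
        omega
      · push Not at hA
        exact (h.count_le_of_notMem hA).trans ih
  obtain ⟨n, hn⟩ := G.exists_bound_of_shortBlock (k * Fintype.card G.N) k f
  refine mem_finCD_of_le hG hL (n := n) fun w hw => hn w ?_
  rw [CDSystem.language_eq] at hw
  have hstep : ∀ x y, G.BStep ⊤ f x y → Relation.ReflTransGen (G.BStep ⊤ f) y (ofWord G.N w) →
      G.ShortBlock (k * Fintype.card G.N) k f x y := by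
    rintro x y h hy
    refine ⟨?_, ?_⟩
    · rw [ntCount_eq]
      exact length_le_of_count_le (hcount w x (.head h hy))
    · obtain ⟨i, m, h, hm⟩ := h
      exact ⟨i, m, (hf hm).1, h, hm⟩
  have key : ∀ x, Relation.TransGen (G.BStep ⊤ f) x (ofWord G.N w) →
      Relation.TransGen (G.ShortBlock (k * Fintype.card G.N) k f) x (ofWord G.N w) := by
    intro x h
    induction h using Relation.TransGen.head_induction_on with
    | single h => exact .single (hstep _ _ h .refl)
    | head h h' ih => exact .head (hstep _ _ h h'.to_reflTransGen) ih
  exact key _ hw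

/-! ### CD grammar systems with a given family of components -/

theorem Run.eq_of_empty {T : Type u} {N : Type} {b : ℕ∞} {m : ℕ} {x y : Form T N}
    (h : Run ∅ b m x y) : y = x := by
  cases h with
  | refl _ => rfl
  | tail _ hs _ =>
    obtain ⟨r, hr, -⟩ := hs
    exact absurd hr (Set.notMem_empty r)

namespace CDSystem

variable {T : Type u} {N ι : Type} [Finite N] [Finite ι]

/-- The CD grammar system with the components `R j` and an additional empty component. -/
noncomputable def ofFamily (S : N) (R : ι → Set (ContextFreeRule T N))
    (hR : ∀ j, (R j).Finite) : CDSystem T where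
  N := N
  finiteN := inferInstance
  S := S
  -- The index type `ι` may be empty; the additional component makes the degree positive, and having
  -- no rules it changes no form.
  degree := Nat.card (Option ι)
  one_le_degree := Nat.card_pos
  P i := ((Finite.equivFin (Option ι)).symm i).elim ∅ fun j => (hR j).toFinset

variable {S : N} {R : ι → Set (ContextFreeRule T N)} {hR : ∀ j, (R j).Finite}

theorem exists_ofFamily_P (j : ι) :
    ∃ i, ((ofFamily S R hR).P i : Set (ContextFreeRule T (ofFamily S R hR).N)) = R j := by
  refine ⟨Finite.equivFin (Option ι) (some j), ?_⟩
  change ((((Finite.equivFin (Option ι)).symm (Finite.equivFin (Option ι) (some j))).elim ∅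
    fun j => (hR j).toFinset : Finset _) : Set (ContextFreeRule T N)) = R j
  rw [Equiv.symm_apply_apply]
  simp

theorem ofFamily_P (i : Fin (ofFamily S R hR).degree) :
    ((ofFamily S R hR).P i : Set (ContextFreeRule T (ofFamily S R hR).N)) = ∅ ∨
      ∃ j, ((ofFamily S R hR).P i : Set (ContextFreeRule T (ofFamily S R hR).N)) = R j := by
  change ((((Finite.equivFin (Option ι)).symm i).elim ∅
    fun j => (hR j).toFinset : Finset _) : Set (ContextFreeRule T N)) = ∅ ∨
    ∃ j, ((((Finite.equivFin (Option ι)).symm i).elim ∅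
    fun j => (hR j).toFinset : Finset _) : Set (ContextFreeRule T N)) = R j
  rcases (Finite.equivFin (Option ι)).symm i with _ | j
  · exact .inl (by simp)
  · exact .inr ⟨j, by simp⟩

/-- If a family of components simulates a machine, then the language of the machine belongs to the
family of finite index. -/
theorem mem_finCD_of_simulation {X : RuleType} {L : Language T} {f : Mode} {M : Machine T}
    (hL : EqModLambda M.language L) (hR : ∀ j, (R j).Finite)
    (hX : ∀ j, ∀ r ∈ R j, X = .cfLambdaFree → r.output ≠ [])
    (inv : Form T N → Prop) (inv_start : inv [.nonterminal S])
    (inv_step : ∀ j x y, inv x → MStep (R j) ⊤ f x y → inv y)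
    (inv_word : ∀ w, inv (ofWord N w) → w ∈ M.language) (k : ℕ)
    (complete : ∀ w ∈ M.language, Relation.ReflTransGen (fun x y => ntCount x ≤ M.bound ∧
      ∃ j, ∃ m ≤ k, Run (R j) ⊤ m x y ∧ ModeOK (R j) f m y) [.nonterminal S] (ofWord N w)) :
    L ∈ finCD T X f := by
  obtain ⟨n, hn⟩ := (ofFamily S R hR).exists_bound_of_shortBlock M.bound k f
  have h1 : (ofFamily S R hR).language f ≤ M.language := by
    intro w hw
    rw [language_eq] at hw
    have key : ∀ y, Relation.TransGen ((ofFamily S R hR).BStep ⊤ f) [.nonterminal S] y →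
        inv y := by
      have hstep : ∀ x y, inv x → (ofFamily S R hR).BStep ⊤ f x y → inv y := by
        rintro x y hx ⟨i, h⟩
        rcases ofFamily_P i with hi | ⟨j, hi⟩
        · rw [hi] at h
          obtain ⟨m, h, -⟩ := h
          exact h.eq_of_empty ▸ hx
        · rw [hi] at h
          exact inv_step j x y hx h
      intro y h
      induction h with
      | single h => exact hstep _ _ inv_start h
      | tail _ h ih => exact hstep _ _ ih h
    exact inv_word w (key _ hw)
  have h2 : M.language ≤ (ofFamily S R hR).boundedLanguage n f := by
    intro w hw
    refine hn w ?_
    rcases Relation.reflTransGen_iff_eq_or_transGen.1 (complete w hw) with h | h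
    · exact absurd h singleton_ne_ofWord
    · refine Relation.TransGen.mono ?_ _ _ h
      rintro x y ⟨hx, j, m, hm, hrun, hf⟩
      obtain ⟨i, hi⟩ := exists_ofFamily_P (S := S) (R := R) (hR := hR) j
      exact ⟨hx, i, m, hm, hi.symm ▸ hrun, hi.symm ▸ hf⟩
  have h3 : (ofFamily S R hR).boundedLanguage n f ≤ (ofFamily S R hR).language f := by
    rw [language_eq]
    exact boundedLanguage_mono le_top
  refine mem_finCD_of_le (G := ofFamily S R hR) ?_ ?_ (h1.trans h2)
  · intro i r hr
    have hr : r ∈ ((ofFamily S R hR).P i : Set (ContextFreeRule T (ofFamily S R hR).N)) := hr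
    rcases ofFamily_P i with hi | ⟨j, hi⟩
    · rw [hi] at hr
      exact absurd hr (Set.notMem_empty r)
    · rw [hi] at hr
      exact RuleType.allows_iff.2 (hX j r hr)
  · rwa [le_antisymm h1 (h2.trans h3)]

end CDSystem

/-! ### Encoding the state of a machine in one nonterminal -/

/-- Nonterminals of the simulating systems: names of the machine, names that carry a state, and
auxiliary symbols. -/
inductive NT (V Q P : Type) : Type
  | plain (v : V)
  | head (v : V) (q : Q)
  | aux (p : P)

instance {V Q P : Type} [Finite V] [Finite Q] [Finite P] : Finite (NT V Q P) := by
  refine Finite.of_injective (β := V ⊕ (V × Q) ⊕ P) (fun s => match s with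
    | .plain v => .inl v
    | .head v q => .inr (.inl (v, q))
    | .aux p => .inr (.inr p)) ?_
  rintro (_ | _ | _) (_ | _ | _) h <;> simp_all

section Encoding

variable {T : Type u} {N N' : Type}

theorem mem_nts_rename {φ : N → N'} {x : Form T N} {B : N'} :
    B ∈ nts (rename φ x) ↔ ∃ w ∈ nts x, φ w = B := by
  rw [nts_rename, List.mem_map]

theorem ntCount_rename (φ : N → N') (x : Form T N) : ntCount (rename φ x) = ntCount x := by
  rw [ntCount_eq, ntCount_eq, nts_rename, List.length_map]

theorem rename_ne_nil {φ : N → N'} {x : Form T N} (h : x ≠ []) : rename φ x ≠ [] := by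
  rw [rename_eq_map]
  simpa using h

theorem bindN_rename {L : Type} (h : N' → Form T L) (φ : N → N') (x : Form T N) :
    bindN h (rename φ x) = bindN (fun w => h (φ w)) x := by
  simp [rename, bindN_bindN]

open Classical in
/-- Renaming after substitution, as one substitution. -/
theorem rename_subst (φ : N → N') (A : N) (z x : Form T N) :
    rename φ (subst A z x) =
      bindN (fun w => if w = A then rename φ z else [.nonterminal (φ w)]) x := by
  rw [rename, subst, bindN_bindN]
  refine bindN_congr fun w _ => ?_
  split_ifs <;> simp [rename]

open Classical in
/-- Substitution after renaming, as one substitution. -/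
theorem subst_rename (φ : N → N') (A : N') (z : Form T N') (x : Form T N) :
    subst A z (rename φ x) = bindN (fun w => if φ w = A then z else [.nonterminal (φ w)]) x :=
  bindN_rename _ _ _

theorem nodup_nts_rename {φ : N → N'} {x : Form T N} (hx : (nts x).Nodup)
    (hφ : Function.Injective φ) : (nts (rename φ x)).Nodup := by
  rw [nts_rename]
  exact hx.map hφ

end Encoding

namespace Machine

variable {T : Type u} (M : Machine T)

/-- Transitions together with a name in the output that will carry the state. -/
abbrev SoloOp : Type := {o : M.Tr × M.V // o.2 ∈ nts (M.out o.1) ∨ M.nm (M.tgt o.1) = []}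

/-- Transitions together with an old name that will carry the state. -/
abbrev PairOp : Type := {p : M.Tr × M.V // p.2 ∈ M.nm (M.src p.1) ∧ p.2 ≠ M.var p.1}

theorem finite_soloOp : Finite M.SoloOp :=
  have := M.finiteTr
  have := M.finiteV
  inferInstance

theorem finite_pairOp : Finite M.PairOp :=
  have := M.finiteTr
  have := M.finiteV
  inferInstance

variable {M} {P : Type}

open Classical in
/-- The name `u` carries the state `q`. -/
noncomputable def carry (P : Type) (u : M.V) (q : M.Q) (w : M.V) : NT M.V M.Q P :=
  if w = u then .head w q else .plain w

theorem carry_injective (u : M.V) (q : M.Q) : Function.Injective (carry P u q) := by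
  intro v w h
  unfold carry at h
  split_ifs at h <;> simp_all

theorem carry_eq_head {u v w : M.V} {q q' : M.Q} :
    carry P u q w = .head v q' ↔ w = u ∧ w = v ∧ q = q' := by
  unfold carry
  split_ifs with h <;> simp [h]

theorem carry_eq_plain {u v w : M.V} {q : M.Q} :
    carry P u q w = .plain v ↔ w ≠ u ∧ w = v := by
  unfold carry
  split_ifs with h <;> simp [h]

theorem carry_ne_aux {u w : M.V} {q : M.Q} {p : P} : carry P u q w ≠ .aux p := by
  unfold carry
  split_ifs <;> simp

theorem mem_nm_tgt {τ : M.Tr} {w : M.V} :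
    w ∈ M.nm (M.tgt τ) ↔ w ∈ nts (M.out τ) ∨ (w ∈ M.nm (M.src τ) ∧ w ≠ M.var τ) := by
  rw [M.nm_tgt, subst, mem_nts_bindN, nts_map_nonterminal]
  constructor
  · rintro ⟨A, hA, h⟩
    split_ifs at h with h1
    · exact .inl h
    · obtain rfl : w = A := by simpa using h
      exact .inr ⟨hA, h1⟩
  · rintro (h | ⟨h1, h2⟩)
    · exact ⟨M.var τ, M.var_mem τ, by simpa using h⟩
    · exact ⟨w, h1, by simp [h2]⟩

/-- A surviving old name cannot be mistaken for the new carrier: the carrier is fresh, unless no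
names survive at all. -/
theorem SoloOp.ne (o : M.SoloOp) {w : M.V} (hw : w ∈ M.nm (M.src o.1.1))
    (hv : w ≠ M.var o.1.1) : w ≠ o.1.2 := by
  rintro rfl
  rcases o.2 with h | h
  · exact M.fresh _ _ h hw
  · have := mem_nm_tgt.2 (.inr ⟨hw, hv⟩)
    simp [h] at this

theorem SoloOp.carrier (o : M.SoloOp) :
    o.1.2 ∈ M.nm (M.tgt o.1.1) ∨ M.nm (M.tgt o.1.1) = [] :=
  o.2.imp_left fun h => mem_nm_tgt.2 (.inl h)

theorem PairOp.notMem_out (p : M.PairOp) : p.1.2 ∉ nts (M.out p.1.1) := fun h =>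
  M.fresh _ _ h p.2.1

theorem PairOp.carrier (p : M.PairOp) :
    p.1.2 ∈ M.nm (M.tgt p.1.1) ∨ M.nm (M.tgt p.1.1) = [] :=
  .inl (mem_nm_tgt.2 (.inr p.2))

/-- The effect of a solo operation. -/
theorem SoloOp.subst_eq (o : M.SoloOp) {y : Form T M.V} (hy : M.Reach y (M.src o.1.1)) :
    subst (.head (M.var o.1.1) (M.src o.1.1))
      (rename (carry P o.1.2 (M.tgt o.1.1)) (M.out o.1.1))
      (rename (carry P (M.var o.1.1) (M.src o.1.1)) y) =
    rename (carry P o.1.2 (M.tgt o.1.1)) (subst (M.var o.1.1) (M.out o.1.1) y) := by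
  classical
  rw [rename_subst, subst_rename]
  refine bindN_congr fun w hw => ?_
  rw [hy.nts_eq] at hw
  by_cases hv : w = M.var o.1.1
  · simp [hv, carry]
  · simp [hv, carry, o.ne hw hv]

/-- If every operation can be simulated, then every word of the machine can be derived. -/
theorem simulation_complete {R : Form T (NT M.V M.Q P) → Form T (NT M.V M.Q P) → Prop}
    (solo : ∀ (o : M.SoloOp) (y : Form T M.V), M.Reach y (M.src o.1.1) →
      Relation.ReflTransGen R (rename (carry P (M.var o.1.1) (M.src o.1.1)) y)
        (rename (carry P o.1.2 (M.tgt o.1.1)) (subst (M.var o.1.1) (M.out o.1.1) y)))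
    (pair : ∀ (p : M.PairOp) (y : Form T M.V), M.Reach y (M.src p.1.1) →
      Relation.ReflTransGen R (rename (carry P (M.var p.1.1) (M.src p.1.1)) y)
        (rename (carry P p.1.2 (M.tgt p.1.1)) (subst (M.var p.1.1) (M.out p.1.1) y)))
    (w : List T) (hw : w ∈ M.language) :
    Relation.ReflTransGen R [.nonterminal (.head M.v₀ M.q₀)] (ofWord _ w) := by
  obtain ⟨q, hq⟩ := hw
  -- The claim covers every possible carrier `u`, since the carrier has to be the name that the next
  -- transition replaces and must be guessed one transition ahead.
  have key : ∀ y q, M.Reach y q → ∀ u, u ∈ M.nm q ∨ M.nm q = [] →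
      Relation.ReflTransGen R [.nonterminal (.head M.v₀ M.q₀)] (rename (carry P u q) y) := by
    intro y q h
    induction h with
    | start =>
      intro u hu
      obtain rfl : u = M.v₀ := by simpa [M.nm_q₀] using hu
      simpa [rename, carry] using Relation.ReflTransGen.refl
    | @step y τ h ih =>
      intro u hu
      refine (ih (M.var τ) (.inl (M.var_mem τ))).trans ?_
      by_cases ho : u ∈ nts (M.out τ) ∨ M.nm (M.tgt τ) = []
      · exact solo ⟨(τ, u), ho⟩ y h
      · rw [mem_nm_tgt] at hu
        rcases hu with (hu | hu) | hu
        · exact absurd (.inl hu) ho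
        · exact pair ⟨(τ, u), hu⟩ y h
        · exact absurd (.inr hu) ho
  have h := key _ q hq M.v₀ (.inr (by rw [← hq.nts_eq, nts_ofWord]))
  rwa [rename_ofWord] at h

end Machine

/-! ### Simulation in the terminating modes -/

section Guarded

variable {T : Type u} {N : Type}

/-- The component that replaces `A` by `z` in the absence of the symbols of `F`. -/
def guarded (A : N) (z : Form T N) (F : Set N) : Set (ContextFreeRule T N) :=
  {⟨A, [.nonterminal A]⟩, ⟨A, z⟩} ∪ (fun B => ⟨B, [.nonterminal B]⟩) '' F

theorem finite_guarded [Finite N] (A : N) (z : Form T N) (F : Set N) : (guarded A z F).Finite :=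
  (Set.toFinite _).union ((Set.toFinite F).image _)

theorem output_ne_nil_of_mem_guarded {A : N} {z : Form T N} {F : Set N} (hz : z ≠ [])
    {r : ContextFreeRule T N} (hr : r ∈ guarded A z F) : r.output ≠ [] := by
  rcases hr with (rfl | rfl) | ⟨B, -, rfl⟩
  · simp
  · exact hz
  · simp

variable {A : N} {z x y : Form T N} {F : Set N}

theorem no_rstep_guarded_iff : (¬ ∃ y', RStep (guarded A z F) y y') ↔
    A ∉ nts y ∧ ∀ B ∈ F, B ∉ nts y := by
  rw [exists_rstep_iff]
  constructor
  · intro h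
    exact ⟨fun hA => h ⟨_, .inl (.inl rfl), hA⟩, fun B hB hB' => h ⟨_, .inr ⟨B, hB, rfl⟩, hB'⟩⟩
  · rintro ⟨h1, h2⟩ ⟨r, (rfl | rfl) | ⟨B, hB, rfl⟩, hr⟩
    · exact h1 hr
    · exact h1 hr
    · exact h2 B hB hr

/-- Substituting `z` for `A` identifies the two sides of every rule of the component, so it is
invariant along the run. -/
theorem Run.subst_eq_of_guarded (hz : A ∉ nts z) (hF : A ∉ F) {m : ℕ}
    (h : Run (guarded A z F) ⊤ m x y) : subst A z x = subst A z y := by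
  classical
  induction h with
  | refl _ => rfl
  | tail _ hs _ ih =>
    obtain ⟨r, hr, hs⟩ := hs
    refine ih.trans (Rewrites.bindN_eq hs ?_)
    change subst A z r.output = _
    rcases hr with (rfl | rfl) | ⟨B, hB, rfl⟩
    · simp
    · simpa using subst_eq_self hz
    · have hBA : B ≠ A := fun h => hF (h ▸ hB)
      rw [subst_eq_self]
      · simp [hBA]
      · simpa using hBA.symm

/-- A completed block of a guarded component has no effect, or replaces `A` by `z`. -/
theorem Run.guarded_sound (hz : A ∉ nts z) (hF : A ∉ F) {m : ℕ}
    (h : Run (guarded A z F) ⊤ m x y) (hy : ¬ ∃ y', RStep (guarded A z F) y y') :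
    y = x ∨ (A ∈ nts x ∧ (∀ B ∈ F, B ∉ nts x) ∧ y = subst A z x) := by
  obtain ⟨h1, h2⟩ := no_rstep_guarded_iff.1 hy
  have h3 := h.subst_eq_of_guarded hz hF
  rw [subst_eq_self h1] at h3
  by_cases hA : A ∈ nts x
  · refine .inr ⟨hA, fun B hB hBx => h2 B hB ?_, h3.symm⟩
    rw [← h3, subst, mem_nts_bindN]
    have hne : B ≠ A := fun h => hF (h ▸ hB)
    exact ⟨B, hBx, by simp [hne]⟩
  · exact .inl (h3.symm.trans (subst_eq_self hA))

/-- Idle with `A → A` for `m - 1` steps, then use `A → z`; as `A` occurs only once, one replacement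
is the whole substitution. -/
theorem Run.guarded_complete (hx : (nts x).Nodup) (hA : A ∈ nts x) {m : ℕ} (hm : 1 ≤ m) :
    Run (guarded A z F) ⊤ m x (subst A z x) := by
  have h : ∀ m, Run (guarded A z F) ⊤ m x x := by
    intro m
    induction m with
    | zero => exact .refl le_top
    | succ m ih =>
      refine .tail ih ⟨_, .inl (.inl rfl), (rewrites_iff_of_nodup hx _).2 ⟨hA, ?_⟩⟩ le_top
      exact (bindN_eq_self fun B _ => by split_ifs with h <;> simp [h]).symm
  obtain ⟨m, rfl⟩ := Nat.exists_eq_add_of_le' hm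
  exact .tail (h m) ⟨_, .inl (.inr rfl), (rewrites_iff_of_nodup hx _).2 ⟨hA, rfl⟩⟩ le_top

end Guarded

namespace Machine

variable {T : Type u} {M : Machine T}

open Classical in
/-- The form after the first phase of a pair operation. -/
noncomputable def phaseOne (p : M.PairOp) (w : M.V) : NT M.V M.Q M.PairOp :=
  if w = M.var p.1.1 then .aux p else .plain w

open Classical in
/-- The form after the second phase of a pair operation. -/
noncomputable def phaseTwo (p : M.PairOp) (w : M.V) : NT M.V M.Q M.PairOp :=
  if w = M.var p.1.1 then .aux p else if w = p.1.2 then .head w (M.tgt p.1.1) else .plain w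

theorem phaseOne_injective (p : M.PairOp) : Function.Injective (phaseOne p) := by
  intro v w h
  unfold phaseOne at h
  split_ifs at h <;> simp_all

theorem phaseTwo_injective (p : M.PairOp) : Function.Injective (phaseTwo p) := by
  intro v w h
  unfold phaseTwo at h
  split_ifs at h <;> simp_all

theorem PairOp.subst_begin (p : M.PairOp) (y : Form T M.V) :
    subst (.head (M.var p.1.1) (M.src p.1.1)) [.nonterminal (.aux p)]
      (rename (carry M.PairOp (M.var p.1.1) (M.src p.1.1)) y) = rename (phaseOne p) y := by
  rw [subst_rename]
  refine bindN_congr fun w _ => ?_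
  by_cases hv : w = M.var p.1.1 <;> simp [hv, carry, phaseOne]

theorem PairOp.subst_move (p : M.PairOp) (y : Form T M.V) :
    subst (.plain p.1.2) [.nonterminal (.head p.1.2 (M.tgt p.1.1))] (rename (phaseOne p) y) =
      rename (phaseTwo p) y := by
  rw [subst_rename]
  refine bindN_congr fun w _ => ?_
  by_cases hv : w = M.var p.1.1
  · simp [hv, phaseOne, phaseTwo]
  · by_cases hb : w = p.1.2
    · simp [hb, phaseOne, phaseTwo, p.2.2]
    · simp [hv, hb, phaseOne, phaseTwo]

theorem PairOp.rename_carry_out {P : Type} (p : M.PairOp) :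
    rename (carry P p.1.2 (M.tgt p.1.1)) (M.out p.1.1) = rename .plain (M.out p.1.1) :=
  bindN_congr fun w hw => by
    have : w ≠ p.1.2 := fun h => p.notMem_out (h ▸ hw)
    simp [carry, this]

theorem PairOp.subst_finish (p : M.PairOp) (y : Form T M.V) :
    subst (.aux p) (rename .plain (M.out p.1.1)) (rename (phaseTwo p) y) =
      rename (carry M.PairOp p.1.2 (M.tgt p.1.1)) (subst (M.var p.1.1) (M.out p.1.1) y) := by
  rw [subst_rename, rename_subst, p.rename_carry_out]
  refine bindN_congr fun w _ => ?_
  by_cases hv : w = M.var p.1.1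
  · simp [hv, phaseTwo]
  · by_cases hb : w = p.1.2
    · simp [hb, phaseTwo, carry, p.2.2]
    · simp [hv, hb, phaseTwo, carry]

variable (M) in
/-- The components for the terminating modes. -/
abbrev GuardedIndex : Type := M.SoloOp ⊕ M.PairOp ⊕ M.PairOp ⊕ M.PairOp

/-- The symbol that a component replaces. -/
def guardedLhs : M.GuardedIndex → NT M.V M.Q M.PairOp
  | .inl o => .head (M.var o.1.1) (M.src o.1.1)
  | .inr (.inl p) => .head (M.var p.1.1) (M.src p.1.1)
  | .inr (.inr (.inl p)) => .plain p.1.2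
  | .inr (.inr (.inr p)) => .aux p

/-- The form that a component inserts. -/
noncomputable def guardedRhs : M.GuardedIndex → Form T (NT M.V M.Q M.PairOp)
  | .inl o => rename (carry M.PairOp o.1.2 (M.tgt o.1.1)) (M.out o.1.1)
  | .inr (.inl p) => [.nonterminal (.aux p)]
  | .inr (.inr (.inl p)) => [.nonterminal (.head p.1.2 (M.tgt p.1.1))]
  | .inr (.inr (.inr p)) => rename .plain (M.out p.1.1)

/-- The symbols that block a component. -/
def guardedForbidden : M.GuardedIndex → Set (NT M.V M.Q M.PairOp)
  | .inl _ => {B | ∃ p, B = .aux p}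
  | .inr (.inl p) => {B | ∃ p', p' ≠ p ∧ B = .aux p'}
  -- In an ordinary form that contains `.plain p.1.2`, the state sits on another name, and that head
  -- blocks the move. The head created by the move is exempt, because it is present when the block
  -- ends.
  | .inr (.inr (.inl p)) => {B | (∃ p', p' ≠ p ∧ B = .aux p') ∨
      ∃ w q, (w, q) ≠ (p.1.2, M.tgt p.1.1) ∧ B = .head w q}
  -- The output may be inserted only after the second phase has turned this symbol into the new
  -- head.
  | .inr (.inr (.inr p)) => {.plain p.1.2}

theorem guardedLhs_notMem_rhs (j : M.GuardedIndex) : guardedLhs j ∉ nts (guardedRhs j) := by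
  rcases j with o | p | p | p
  · simp only [guardedLhs, guardedRhs, mem_nts_rename]
    rintro ⟨w, hw, h⟩
    obtain ⟨-, rfl, -⟩ := carry_eq_head.1 h
    exact var_notMem_out _ hw
  · simp [guardedLhs, guardedRhs]
  · simp [guardedLhs, guardedRhs]
  · simp [guardedLhs, guardedRhs, mem_nts_rename]

theorem guardedLhs_notMem_forbidden (j : M.GuardedIndex) :
    guardedLhs j ∉ guardedForbidden j := by
  rcases j with o | p | p | p <;> simp [guardedLhs, guardedForbidden]

/-- The forms that are reachable at the ends of blocks. -/
def GuardedInv (x : Form T (NT M.V M.Q M.PairOp)) : Prop :=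
  (∃ y q u, M.Reach y q ∧ (u ∈ M.nm q ∨ M.nm q = []) ∧ x = rename (carry M.PairOp u q) y) ∨
  ∃ (p : M.PairOp) (y : Form T M.V), M.Reach y (M.src p.1.1) ∧
    (x = rename (phaseOne p) y ∨ x = rename (phaseTwo p) y)

/-- The forbidden symbols force the order of events: on an ordinary form only a solo operation or
the first phase of a pair operation can complete, and once `.aux p` is present only the next phase
of the same `p` can. -/
theorem guardedInv_step {j : M.GuardedIndex} {x : Form T (NT M.V M.Q M.PairOp)}
    (hx : GuardedInv x) (hA : guardedLhs j ∈ nts x) (hF : ∀ B ∈ guardedForbidden j, B ∉ nts x) :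
    GuardedInv (subst (guardedLhs j) (guardedRhs j) x) := by
  rcases hx with ⟨y, q, u, hy, hu, rfl⟩ | ⟨p', y, hy, hx⟩
  · obtain ⟨w, hw, hA⟩ := mem_nts_rename.1 hA
    rw [hy.nts_eq] at hw
    rcases j with o | p | p | p
    · obtain ⟨rfl, h2, rfl⟩ := carry_eq_head.1 hA
      refine .inl ⟨_, _, o.1.2, hy.step o.1.1, o.carrier, ?_⟩
      rw [← o.subst_eq hy, h2]
      rfl
    · obtain ⟨rfl, h2, rfl⟩ := carry_eq_head.1 hA
      refine .inr ⟨p, y, hy, .inl ?_⟩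
      rw [← p.subst_begin, h2]
      rfl
    · exfalso
      obtain ⟨h1, h2⟩ := carry_eq_plain.1 hA
      have hu : u ∈ M.nm q := hu.resolve_right fun h => by simp [h] at hw
      refine hF (.head u q) (.inr ⟨u, q, fun h => ?_, rfl⟩)
        (mem_nts_rename.2 ⟨u, hy.nts_eq ▸ hu, by simp [carry]⟩)
      exact h1 (h2.trans (congrArg Prod.fst h).symm)
    · exact absurd hA carry_ne_aux
  · have hv' : M.var p'.1.1 ∈ nts y := hy.nts_eq ▸ M.var_mem p'.1.1
    have haux : .aux p' ∈ nts x := by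
      rcases hx with rfl | rfl
      · exact mem_nts_rename.2 ⟨_, hv', by simp [phaseOne]⟩
      · exact mem_nts_rename.2 ⟨_, hv', by simp [phaseTwo]⟩
    have hb' : p'.1.2 ∈ nts y := hy.nts_eq ▸ p'.2.1
    rcases j with o | p | p | p
    · exact absurd haux (hF _ ⟨p', rfl⟩)
    · obtain rfl : p' = p := by
        by_contra hne
        exact hF _ ⟨p', hne, rfl⟩ haux
      exfalso
      rcases hx with rfl | rfl
      · obtain ⟨w, hw, hA⟩ := mem_nts_rename.1 hA
        simp only [phaseOne, guardedLhs] at hA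
        split_ifs at hA
      · obtain ⟨w, hw, hA⟩ := mem_nts_rename.1 hA
        simp only [phaseTwo, guardedLhs] at hA
        split_ifs at hA with h1 h2
        -- In phase two the only head sits on the older name, which differs from the replaced one,
        -- so the first phase cannot be repeated.
        have h3 : w = M.var p'.1.1 := by simp_all
        exact h1 h3
    · obtain rfl : p' = p := by
        by_contra hne
        exact hF _ (.inl ⟨p', hne, rfl⟩) haux
      rcases hx with rfl | rfl
      · exact .inr ⟨p', y, hy, .inr (p'.subst_move y)⟩
      · exfalso
        obtain ⟨w, hw, hA⟩ := mem_nts_rename.1 hA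
        simp only [phaseTwo, guardedLhs] at hA
        split_ifs at hA with h1 h2
        simp at hA
        exact h2 hA
    · rcases hx with rfl | rfl
      · exfalso
        obtain ⟨w, hw, hA⟩ := mem_nts_rename.1 hA
        simp only [phaseOne, guardedLhs] at hA
        split_ifs at hA with h1
        obtain rfl : p' = p := by simpa using hA
        exact hF (.plain p'.1.2) rfl (mem_nts_rename.2 ⟨_, hb', by simp [phaseOne, p'.2.2]⟩)
      · obtain ⟨w, hw, hA⟩ := mem_nts_rename.1 hA
        simp only [phaseTwo, guardedLhs] at hA
        split_ifs at hA with h1 h2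
        obtain rfl : p' = p := by simpa using hA
        exact .inl ⟨_, _, p'.1.2, hy.step p'.1.1, p'.carrier, p'.subst_finish y⟩

variable {X : RuleType} {L : Language T} {f : Mode}

/-- Completeness for one component: the block is padded to `m` steps, and it terminates as soon as
the resulting form contains no forbidden symbol, because the replaced symbol never occurs in the
inserted form. -/
theorem guarded_block {j : M.GuardedIndex} {m : ℕ} (hm : 1 ≤ m)
    (hf : ∀ {N : Type} {R : Set (ContextFreeRule T N)} {y : Form T N},
      (¬ ∃ z, RStep R y z) → ModeOK R f m y)
    {φ : M.V → NT M.V M.Q M.PairOp} (hφ : Function.Injective φ) {y : Form T M.V} {q : M.Q}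
    (hy : M.Reach y q) {x' : Form T (NT M.V M.Q M.PairOp)}
    (hx' : subst (guardedLhs j) (guardedRhs j) (rename φ y) = x')
    (hA : guardedLhs j ∈ nts (rename φ y)) (hF : ∀ B ∈ guardedForbidden j, B ∉ nts x') :
    ntCount (rename φ y) ≤ M.bound ∧ ∃ j : M.GuardedIndex, ∃ m' ≤ m,
      Run (guarded (guardedLhs j) (guardedRhs j) (guardedForbidden j)) ⊤ m' (rename φ y) x' ∧
      ModeOK (guarded (guardedLhs j) (guardedRhs j) (guardedForbidden j)) f m' x' := by
  subst hx'
  refine ⟨ntCount_rename φ y ▸ hy.ntCount_le, j, m, le_rfl,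
    Run.guarded_complete (nodup_nts_rename hy.nodup hφ) hA hm, hf ?_⟩
  exact no_rstep_guarded_iff.2 ⟨notMem_nts_subst (guardedLhs_notMem_rhs j), hF⟩

/-- Simulation of machines in terminating modes. -/
theorem mem_finCD_of_terminating (hM : M.HasType X) (hL : EqModLambda M.language L)
    (hf₁ : ∀ {N : Type} {R : Set (ContextFreeRule T N)} {m : ℕ} {y : Form T N},
      ModeOK R f m y → ¬ ∃ z, RStep R y z) {m : ℕ} (hm : 1 ≤ m)
    (hf₂ : ∀ {N : Type} {R : Set (ContextFreeRule T N)} {y : Form T N},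
      (¬ ∃ z, RStep R y z) → ModeOK R f m y) : L ∈ finCD T X f := by
  have := M.finiteV
  have := M.finiteQ
  have := M.finite_soloOp
  have := M.finite_pairOp
  refine CDSystem.mem_finCD_of_simulation (N := NT M.V M.Q M.PairOp) (ι := M.GuardedIndex)
    (S := .head M.v₀ M.q₀)
    (R := fun j => guarded (guardedLhs j) (guardedRhs j) (guardedForbidden j)) hL
    (fun j => finite_guarded _ _ _) ?_ GuardedInv ?_ ?_ ?_ m ?_
  · intro j r hr hX
    refine output_ne_nil_of_mem_guarded ?_ hr
    rcases j with o | p | p | p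
    · exact rename_ne_nil (hM _ hX)
    · simp [guardedRhs]
    · simp [guardedRhs]
    · exact rename_ne_nil (hM _ hX)
  · exact .inl ⟨_, _, M.v₀, .start, .inl (by simp [M.nm_q₀]), by simp [rename, carry]⟩
  · rintro j x y hx ⟨m, h, hm⟩
    rcases h.guarded_sound (guardedLhs_notMem_rhs j) (guardedLhs_notMem_forbidden j) (hf₁ hm) with
      rfl | ⟨hA, hF, rfl⟩
    · exact hx
    · exact guardedInv_step hx hA hF
  · rintro w (⟨y, q, u, hy, -, h⟩ | ⟨p, y, hy, h⟩)
    · have h0 := congrArg nts h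
      rw [nts_ofWord, nts_rename, eq_comm, List.map_eq_nil_iff] at h0
      obtain ⟨w', rfl⟩ := nts_eq_nil.1 h0
      rw [rename_ofWord] at h
      exact ⟨q, ofWord_injective h ▸ hy⟩
    · exfalso
      have hv : M.var p.1.1 ∈ nts y := hy.nts_eq ▸ M.var_mem p.1.1
      have h0 : nts y = [] := by
        rcases h with h | h <;>
        · have h0 := congrArg nts h
          rwa [nts_ofWord, nts_rename, eq_comm, List.map_eq_nil_iff] at h0
      simp [h0] at hv
  · intro w hw
    refine simulation_complete (P := M.PairOp) ?_ ?_ w hw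
    · intro o y hy
      have hv : M.var o.1.1 ∈ nts y := hy.nts_eq ▸ M.var_mem o.1.1
      refine .single (guarded_block (j := .inl o) hm hf₂ (carry_injective _ _) hy
        (o.subst_eq hy) (mem_nts_rename.2 ⟨_, hv, by simp [carry, guardedLhs]⟩) ?_)
      rintro B ⟨p, rfl⟩ hB
      obtain ⟨w, -, h⟩ := mem_nts_rename.1 hB
      exact carry_ne_aux h
    · intro p y hy
      have hv : M.var p.1.1 ∈ nts y := hy.nts_eq ▸ M.var_mem p.1.1
      have hb : p.1.2 ∈ nts y := hy.nts_eq ▸ p.2.1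
      refine .head (guarded_block (j := .inr (.inl p)) hm hf₂ (carry_injective _ _) hy
        (p.subst_begin y) (mem_nts_rename.2 ⟨_, hv, by simp [carry, guardedLhs]⟩) ?_) ?_
      · rintro B ⟨p', hne, rfl⟩ hB
        obtain ⟨w, -, h⟩ := mem_nts_rename.1 hB
        simp only [phaseOne] at h
        split_ifs at h
        exact hne (by simpa using h.symm)
      refine .head (guarded_block (j := .inr (.inr (.inl p))) hm hf₂ (phaseOne_injective p) hy
        (p.subst_move y) (mem_nts_rename.2 ⟨_, hb, by simp [phaseOne, guardedLhs, p.2.2]⟩) ?_) ?_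
      · rintro B (⟨p', hne, rfl⟩ | ⟨w', q', hne, rfl⟩) hB
        · obtain ⟨w, -, h⟩ := mem_nts_rename.1 hB
          simp only [phaseTwo] at h
          split_ifs at h
          exact hne (by simpa using h.symm)
        · obtain ⟨w, -, h⟩ := mem_nts_rename.1 hB
          simp only [phaseTwo] at h
          split_ifs at h with h1 h2
          exact hne (by simp_all)
      refine .single (guarded_block (j := .inr (.inr (.inr p))) hm hf₂ (phaseTwo_injective p) hy
        (p.subst_finish y) (mem_nts_rename.2 ⟨_, hv, by simp [phaseTwo, guardedLhs]⟩) ?_)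
      rintro B rfl hB
      obtain ⟨w, -, h⟩ := mem_nts_rename.1 hB
      obtain ⟨h1, h2⟩ := carry_eq_plain.1 h
      exact h1 h2

end Machine

/-! ### Simulation in the modes `= k` and `≥ k` -/

section Weights

variable {T : Type u} {N M : Type} {R : Set (ContextFreeRule T N)} {m : ℕ} {x y : Form T N}

/-- The total weight of the nonterminal occurrences of a form. -/
def weight (wt : N → ℕ) (x : Form T N) : ℕ := ((nts x).map wt).sum

theorem Run.weight_eq {wt : N → ℕ} (hR : ∀ r ∈ R, wt r.input = weight wt r.output + 1)
    (h : Run R ⊤ m x y) : weight wt x = weight wt y + m := by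
  induction h with
  | refl _ => rfl
  | tail _ hs _ ih =>
    obtain ⟨r, hr, hs⟩ := hs
    obtain ⟨p, q, rfl, rfl⟩ := hs.exists_parts
    have := hR r hr
    simp only [weight, nts_append, nts_nonterminal_cons, nts_nil, List.map_append,
      List.sum_append, List.map_cons, List.map_nil, List.sum_cons, List.sum_nil] at *
    omega

theorem Run.bindN_eq {g : N → Form T M} (hR : ∀ r ∈ R, bindN g r.output = g r.input)
    (h : Run R ⊤ m x y) : bindN g x = bindN g y := by
  induction h with
  | refl _ => rfl
  | tail _ hs _ ih =>
    obtain ⟨r, hr, hs⟩ := hs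
    exact ih.trans (Rewrites.bindN_eq hs (hR r hr))

/-- No termination condition is needed here: `A` occurs at most once, so after `A → z` the component
has nothing left to rewrite. -/
theorem Run.guarded_empty_sound {A : N} {z : Form T N} (hz : A ∉ nts z) (hx : (nts x).Nodup)
    (h : Run (guarded A z ∅) ⊤ m x y) : y = x ∨ (A ∈ nts x ∧ y = subst A z x) := by
  induction h with
  | refl _ => exact .inl rfl
  | tail _ hs _ ih =>
    obtain ⟨r, hr, hs⟩ := hs
    have hin : r.input = A := by
      rcases hr with (rfl | rfl) | ⟨B, hB, -⟩
      · rfl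
      · rfl
      · exact absurd hB (Set.notMem_empty B)
    rcases ih hx with rfl | ⟨-, rfl⟩
    · obtain ⟨hA, rfl⟩ := (rewrites_iff_of_nodup hx r).1 hs
      rcases hr with (rfl | rfl) | ⟨B, hB, -⟩
      · exact .inl (bindN_eq_self fun B _ => by split_ifs with h <;> simp [h])
      · exact .inr ⟨hA, rfl⟩
      · exact absurd hB (Set.notMem_empty B)
    · exact absurd (hin ▸ Rewrites.input_mem hs) (notMem_nts_subst hz)

theorem sum_map_ite_le [DecidableEq N] {l : List N} (hl : l.Nodup) (a : N) (c : ℕ) :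
    (l.map fun w => if w = a then c else 0).sum ≤ c := by
  induction l with
  | nil => simp
  | cons b l ih =>
    obtain ⟨hb, hl⟩ := List.nodup_cons.1 hl
    simp only [List.map_cons, List.sum_cons]
    split_ifs with h
    · subst h
      have : (l.map fun w => if w = b then c else 0).sum = 0 := by
        refine List.sum_eq_zero fun n hn => ?_
        obtain ⟨w, hw, rfl⟩ := List.mem_map.1 hn
        exact if_neg fun h : w = b => hb (h ▸ hw)
      omega
    · simpa using ih hl

end Weights

namespace Machine

variable {T : Type u} {M : Machine T} {k : ℕ}

/-- The symbol from which `j` chain steps of the pair operation remain. -/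
def chainSym (p : M.PairOp) (j : Fin k) : NT M.V M.Q (M.PairOp × Fin k) :=
  if j.val + 1 = k then .head (M.var p.1.1) (M.src p.1.1) else .aux (p, j)

/-- The component that performs a pair operation in exactly `k` steps. -/
def pairRules (k : ℕ) (p : M.PairOp) : Set (ContextFreeRule T (NT M.V M.Q (M.PairOp × Fin k))) :=
  -- The chain runs from level `k - 1`, the head, down to level `1` in `k - 2` steps. Inserting the
  -- output and moving the state to the older name take one step each, in total `k`.
  (fun j : Fin k × Fin k => ⟨chainSym p j.1, [.nonterminal (chainSym p j.2)]⟩) ''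
      {j | j.1.val = j.2.val + 1 ∧ 1 ≤ j.2.val} ∪
    (fun j : Fin k => ⟨chainSym p j, rename .plain (M.out p.1.1)⟩) '' {j | j.val = 1} ∪
    {⟨.plain p.1.2, [.nonterminal (.head p.1.2 (M.tgt p.1.1))]⟩}

theorem finite_pairRules (p : M.PairOp) : (pairRules k p).Finite :=
  (((Set.toFinite _).image _).union ((Set.toFinite _).image _)).union (Set.toFinite _)

open Classical in
/-- The number of steps of the pair operation that a symbol still needs. -/
noncomputable def pairWeight (p : M.PairOp) : NT M.V M.Q (M.PairOp × Fin k) → ℕ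
  | .plain w => if w = p.1.2 then 1 else 0
  | .head v q => if v = M.var p.1.1 ∧ q = M.src p.1.1 then k - 1 else 0
  | .aux (p', j) => if p' = p then j.val else 0

open Classical in
/-- The final result of the pair operation on a symbol. -/
noncomputable def pairResult (p : M.PairOp) (A : NT M.V M.Q (M.PairOp × Fin k)) :
    Form T (NT M.V M.Q (M.PairOp × Fin k)) :=
  if A = .plain p.1.2 then [.nonterminal (.head p.1.2 (M.tgt p.1.1))]
  else if pairWeight p A = 0 then [.nonterminal A]
  else rename .plain (M.out p.1.1)

theorem pairWeight_chainSym (p : M.PairOp) (j : Fin k) : pairWeight p (chainSym p j) = j.val := by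
  unfold chainSym
  split_ifs with h
  · simp only [pairWeight, and_self, if_true]
    omega
  · simp [pairWeight]

theorem chainSym_ne_plain (p : M.PairOp) (j : Fin k) (w : M.V) : chainSym p j ≠ .plain w := by
  unfold chainSym
  split_ifs <;> simp

theorem pairWeight_head (p : M.PairOp) (q : M.Q) :
    pairWeight (k := k) p (.head p.1.2 q) = 0 := by
  simp [pairWeight, p.2.2]

theorem weight_out (p : M.PairOp) :
    weight (pairWeight (k := k) p) (rename .plain (M.out p.1.1)) = 0 := by
  refine List.sum_eq_zero fun n hn => ?_
  obtain ⟨A, hA, rfl⟩ := List.mem_map.1 hn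
  obtain ⟨w, hw, rfl⟩ := mem_nts_rename.1 hA
  exact if_neg fun h : w = p.1.2 => p.notMem_out (h ▸ hw)

theorem pairWeight_rule (p : M.PairOp) {r : ContextFreeRule T (NT M.V M.Q (M.PairOp × Fin k))}
    (hr : r ∈ pairRules k p) :
    pairWeight p r.input = weight (pairWeight p) r.output + 1 := by
  rcases hr with (⟨j, hj, rfl⟩ | ⟨j, hj, rfl⟩) | rfl
  · simp [weight, pairWeight_chainSym, hj.1]
  · simp only [pairWeight_chainSym, weight_out]
    exact hj
  · simp only [weight, nts_nonterminal_cons, nts_nil, List.map_cons, List.map_nil,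
      List.sum_cons, List.sum_nil, pairWeight_head]
    simp [pairWeight]

theorem bindN_pairResult_of_weight {p : M.PairOp} {x : Form T (NT M.V M.Q (M.PairOp × Fin k))}
    (hx : weight (pairWeight p) x = 0) : bindN (pairResult p) x = x := by
  refine bindN_eq_self fun A hA => ?_
  have h0 : pairWeight p A = 0 := List.sum_eq_zero_iff.1 hx _ (List.mem_map_of_mem hA)
  have h1 : A ≠ .plain p.1.2 := by
    rintro rfl
    simp [pairWeight] at h0
  simp [pairResult, h0, h1]

theorem pairResult_chainSym (p : M.PairOp) {j : Fin k} (hj : 1 ≤ j.val) :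
    pairResult p (chainSym p j) = rename .plain (M.out p.1.1) := by
  rw [pairResult, if_neg (chainSym_ne_plain _ _ _), if_neg]
  rw [pairWeight_chainSym]
  omega

theorem pairResult_rule (p : M.PairOp) {r : ContextFreeRule T (NT M.V M.Q (M.PairOp × Fin k))}
    (hr : r ∈ pairRules k p) : bindN (pairResult p) r.output = pairResult p r.input := by
  rcases hr with (⟨j, hj, rfl⟩ | ⟨j, hj, rfl⟩) | rfl
  · have h1 : 1 ≤ j.1.val := by have := hj.1; omega
    simp [pairResult_chainSym p hj.2, pairResult_chainSym p h1]
  · have h1 : 1 ≤ j.val := le_of_eq hj.symm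
    simp only [pairResult_chainSym p h1]
    exact bindN_pairResult_of_weight (weight_out p)
  · rw [bindN_pairResult_of_weight (by simp [weight, pairWeight_head])]
    simp [pairResult]

/-- The effect of a pair operation. -/
theorem bindN_pairResult (hk : 2 ≤ k) (p : M.PairOp) (y : Form T M.V) :
    bindN (pairResult p) (rename (carry (M.PairOp × Fin k) (M.var p.1.1) (M.src p.1.1)) y) =
      rename (carry _ p.1.2 (M.tgt p.1.1)) (subst (M.var p.1.1) (M.out p.1.1) y) := by
  rw [bindN_rename, rename_subst, p.rename_carry_out]
  refine bindN_congr fun w _ => ?_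
  have hk' : k - 1 ≠ 0 := by omega
  by_cases hv : w = M.var p.1.1
  · simp [hv, carry, pairResult, pairWeight, hk']
  · by_cases hb : w = p.1.2
    · simp [hb, carry, pairResult, p.2.2]
    · simp [hv, hb, carry, pairResult, pairWeight]

/-- Only the unique head and at most one copy of `.plain p.1.2` can contribute. -/
theorem weight_carry_le (p : M.PairOp) {y : Form T M.V} (hy : (nts y).Nodup) (u : M.V) (q : M.Q) :
    weight (pairWeight p) (rename (carry (M.PairOp × Fin k) u q) y) ≤
      pairWeight (k := k) p (.head u q) + 1 := by
  classical
  rw [weight, nts_rename, List.map_map]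
  calc _ ≤ ((nts y).map fun w => (if w = u then pairWeight (k := k) p (.head u q) else 0) +
        if w = p.1.2 then 1 else 0).sum := by
        refine List.sum_le_sum fun w _ => ?_
        by_cases hw : w = u
        · simp [hw, carry]
        · simp [hw, carry, pairWeight]
    _ ≤ _ := by
        rw [List.sum_map_add]
        exact add_le_add (sum_map_ite_le hy _ _) (sum_map_ite_le hy _ _)

/-- Each step uses up one unit of weight. With the wrong head the weight is at most `1 < k`, so no
block of `k` steps exists. With the right head it is at most `k`, so the block exhausts it, and the
invariant substitution `pairResult` then determines the form reached. -/
theorem pair_run_sound (hk : 2 ≤ k) (p : M.PairOp) {y : Form T M.V} (hy : (nts y).Nodup)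
    {u : M.V} {q : M.Q} {m : ℕ} (hm : k ≤ m) {x' : Form T (NT M.V M.Q (M.PairOp × Fin k))}
    (h : Run (pairRules k p) ⊤ m (rename (carry _ u q) y) x') :
    u = M.var p.1.1 ∧ q = M.src p.1.1 ∧
      x' = rename (carry _ p.1.2 (M.tgt p.1.1)) (subst (M.var p.1.1) (M.out p.1.1) y) := by
  have h1 := h.weight_eq fun r hr => pairWeight_rule p hr
  have h2 := h.bindN_eq fun r hr => pairResult_rule p hr
  have h3 := weight_carry_le (k := k) p hy u q
  by_cases huq : u = M.var p.1.1 ∧ q = M.src p.1.1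
  · obtain ⟨rfl, rfl⟩ := huq
    refine ⟨rfl, rfl, ?_⟩
    rw [← bindN_pairResult hk, h2, bindN_pairResult_of_weight]
    simp only [pairWeight, and_self, if_true] at h3
    omega
  · simp only [pairWeight, huq, if_false] at h3
    omega

theorem chain_run (p : M.PairOp) (s t : Form T (NT M.V M.Q (M.PairOp × Fin k))) (n : ℕ)
    (hn : n + 1 < k) : Run (pairRules k p) ⊤ (n + 1)
      (s ++ [.nonterminal (chainSym p ⟨n + 1, hn⟩)] ++ t)
      (s ++ rename .plain (M.out p.1.1) ++ t) := by
  induction n with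
  | zero =>
    refine .tail (.refl le_top) ⟨_, .inl (.inr ⟨⟨0 + 1, hn⟩, rfl, rfl⟩), ?_⟩ le_top
    exact ContextFreeRule.rewrites_of_exists_parts _ _ _
  | succ n ih =>
    have h1 : Run (pairRules k p) ⊤ 1 (s ++ [.nonterminal (chainSym p ⟨n + 1 + 1, hn⟩)] ++ t)
        (s ++ [.nonterminal (chainSym p ⟨n + 1, by omega⟩)] ++ t) := by
      refine .tail (.refl le_top) ⟨_, .inl (.inl ⟨(⟨n + 1 + 1, hn⟩, ⟨n + 1, by omega⟩),
        ⟨rfl, Nat.le_add_left _ _⟩, rfl⟩), ?_⟩ le_top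
      exact ContextFreeRule.rewrites_of_exists_parts _ _ _
    have h2 := h1.trans (ih (by omega))
    rwa [add_comm 1] at h2

theorem pair_run_complete (hk : 2 ≤ k) (p : M.PairOp) {y : Form T M.V}
    (hy : M.Reach y (M.src p.1.1)) :
    Run (pairRules k p) ⊤ k (rename (carry _ (M.var p.1.1) (M.src p.1.1)) y)
      (rename (carry _ p.1.2 (M.tgt p.1.1)) (subst (M.var p.1.1) (M.out p.1.1) y)) := by
  set x := rename (carry (M.PairOp × Fin k) (M.var p.1.1) (M.src p.1.1)) y with hx
  have hv : M.var p.1.1 ∈ nts y := hy.nts_eq ▸ M.var_mem p.1.1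
  have hb : p.1.2 ∈ nts y := hy.nts_eq ▸ p.2.1
  have hvx : NT.head (M.var p.1.1) (M.src p.1.1) ∈ nts x :=
    mem_nts_rename.2 ⟨_, hv, by simp [carry]⟩
  have hbx : NT.plain p.1.2 ∈ nts x := mem_nts_rename.2 ⟨_, hb, by simp [carry, p.2.2]⟩
  obtain ⟨s, t, hst⟩ := exists_split hvx
  obtain ⟨n, rfl⟩ := Nat.exists_eq_add_of_le' hk
  have h1 := chain_run p s t n (by omega)
  rw [show chainSym p (⟨n + 1, by omega⟩ : Fin (n + 2)) =
    .head (M.var p.1.1) (M.src p.1.1) from if_pos rfl, ← hst] at h1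
  have hb' : NT.plain p.1.2 ∈ nts (s ++ rename .plain (M.out p.1.1) ++ t) := by
    rw [hst] at hbx
    simp only [nts_append, nts_nonterminal_cons, nts_nil, List.mem_append, List.mem_singleton,
      reduceCtorEq, or_false] at hbx ⊢
    exact hbx.elim (fun h => .inl (.inl h)) .inr
  -- The result of this last step need not be computed: the run has `k` steps, and `pair_run_sound`
  -- identifies where it ends.
  obtain ⟨e, he⟩ := exists_rewrites_iff (r := (⟨.plain p.1.2,
    [.nonterminal (.head p.1.2 (M.tgt p.1.1))]⟩ :
      ContextFreeRule T (NT M.V M.Q (M.PairOp × Fin (n + 2))))).2 hb'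
  have h2 : Run (pairRules (n + 2) p) ⊤ (n + 2) x e := .tail h1 ⟨_, .inr rfl, he⟩ le_top
  obtain ⟨-, -, rfl⟩ := pair_run_sound hk p hy.nodup le_rfl h2
  exact h2

/-- The components for the modes `= k` and `≥ k`. -/
noncomputable def countingRules (k : ℕ) :
    M.SoloOp ⊕ M.PairOp → Set (ContextFreeRule T (NT M.V M.Q (M.PairOp × Fin k)))
  | .inl o => guarded (.head (M.var o.1.1) (M.src o.1.1))
      (rename (carry _ o.1.2 (M.tgt o.1.1)) (M.out o.1.1)) ∅
  | .inr p => pairRules k p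

/-- Simulation of machines in modes that count up to `k`. -/
theorem mem_finCD_of_counting {X : RuleType} {L : Language T} {f : Mode} (hM : M.HasType X)
    (hL : EqModLambda M.language L) (hk : 2 ≤ k)
    (hf₁ : ∀ {N : Type} {R : Set (ContextFreeRule T N)} {m : ℕ} {y : Form T N},
      ModeOK R f m y → k ≤ m)
    (hf₂ : ∀ {N : Type} {R : Set (ContextFreeRule T N)} {y : Form T N}, ModeOK R f k y) :
    L ∈ finCD T X f := by
  have := M.finiteV
  have := M.finiteQ
  have := M.finite_soloOp
  have := M.finite_pairOp
  have hsolo : ∀ o : M.SoloOp, NT.head (M.var o.1.1) (M.src o.1.1) ∉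
      nts (rename (carry (M.PairOp × Fin k) o.1.2 (M.tgt o.1.1)) (M.out o.1.1)) := by
    intro o h
    obtain ⟨w, hw, h⟩ := mem_nts_rename.1 h
    obtain ⟨-, rfl, -⟩ := carry_eq_head.1 h
    exact var_notMem_out _ hw
  refine CDSystem.mem_finCD_of_simulation (N := NT M.V M.Q (M.PairOp × Fin k))
    (S := .head M.v₀ M.q₀) (R := countingRules k) hL ?_ ?_
    (fun x => ∃ y q u, M.Reach y q ∧ (u ∈ M.nm q ∨ M.nm q = []) ∧ x = rename (carry _ u q) y)
    ?_ ?_ ?_ k ?_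
  · rintro (o | p)
    · exact finite_guarded _ _ _
    · exact finite_pairRules p
  · rintro (o | p) r hr hX
    · exact output_ne_nil_of_mem_guarded (rename_ne_nil (hM _ hX)) hr
    · rcases hr with (⟨j, hj, rfl⟩ | ⟨j, hj, rfl⟩) | rfl
      · simp
      · exact rename_ne_nil (hM _ hX)
      · simp
  · exact ⟨_, _, M.v₀, .start, .inl (by simp [M.nm_q₀]), by simp [rename, carry]⟩
  · rintro (o | p) x x' ⟨y, q, u, hy, hu, rfl⟩ ⟨m, h, hm⟩
    · rcases h.guarded_empty_sound (hsolo o) (nodup_nts_rename hy.nodup (carry_injective u q)) with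
        rfl | ⟨hA, rfl⟩
      · exact ⟨y, q, u, hy, hu, rfl⟩
      · obtain ⟨w, hw, hA⟩ := mem_nts_rename.1 hA
        obtain ⟨rfl, h2, rfl⟩ := carry_eq_head.1 hA
        refine ⟨_, _, o.1.2, hy.step o.1.1, o.carrier, ?_⟩
        rw [← o.subst_eq hy, h2]
    · obtain ⟨rfl, rfl, rfl⟩ := pair_run_sound hk p hy.nodup (hf₁ hm) h
      exact ⟨_, _, p.1.2, hy.step p.1.1, p.carrier, rfl⟩
  · rintro w ⟨y, q, u, hy, -, h⟩
    have h0 := congrArg nts h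
    rw [nts_ofWord, nts_rename, eq_comm, List.map_eq_nil_iff] at h0
    obtain ⟨w', rfl⟩ := nts_eq_nil.1 h0
    rw [rename_ofWord] at h
    exact ⟨q, ofWord_injective h ▸ hy⟩
  · intro w hw
    refine simulation_complete (P := M.PairOp × Fin k) ?_ ?_ w hw
    · intro o y hy
      have hv : M.var o.1.1 ∈ nts y := hy.nts_eq ▸ M.var_mem o.1.1
      refine .single ⟨ntCount_rename _ y ▸ hy.ntCount_le, .inl o, k, le_rfl, ?_, hf₂⟩
      rw [← o.subst_eq hy]
      exact Run.guarded_complete (nodup_nts_rename hy.nodup (carry_injective _ _))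
        (mem_nts_rename.2 ⟨_, hv, by simp [carry]⟩) (by omega)
    · intro p y hy
      exact .single ⟨ntCount_rename _ y ▸ hy.ntCount_le, .inr p, k, le_rfl,
        pair_run_complete hk p hy, hf₂⟩

end Machine

/-! ### The individual modes -/

section Modes

variable {T : Type u} {X : RuleType} {f : Mode} {k : ℕ}

theorem allCD_eq_finP (hf : ∀ {N : Type} {R : Set (ContextFreeRule T N)} {m : ℕ} {y : Form T N},
      ModeOK R f m y → m ≤ k ∧ ¬ ∃ z, RStep R y z) (h : finCD T X f = finP T X) :
    allCD T X f = finP T X :=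
  ((allCD_subset_finCD hf).antisymm finCD_subset_allCD).trans h

variable [Finite T]

theorem finCD_eq_finP_of_terminating
    (hf₁ : ∀ {N : Type} {R : Set (ContextFreeRule T N)} {m : ℕ} {y : Form T N},
      ModeOK R f m y → ¬ ∃ z, RStep R y z) (hk : 1 ≤ k)
    (hf₂ : ∀ {N : Type} {R : Set (ContextFreeRule T N)} {y : Form T N},
      (¬ ∃ z, RStep R y z) → ModeOK R f k y) : finCD T X f = finP T X := by
  refine finCD_subset_finP.antisymm fun L hL => ?_
  obtain ⟨M, hM, hML⟩ := exists_machine_of_mem_finP hL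
  exact Machine.mem_finCD_of_terminating hM hML hf₁ hk hf₂

theorem finCD_eq_finP_of_counting (hk : 2 ≤ k)
    (hf₁ : ∀ {N : Type} {R : Set (ContextFreeRule T N)} {m : ℕ} {y : Form T N},
      ModeOK R f m y → k ≤ m)
    (hf₂ : ∀ {N : Type} {R : Set (ContextFreeRule T N)} {y : Form T N}, ModeOK R f k y) :
    finCD T X f = finP T X := by
  refine finCD_subset_finP.antisymm fun L hL => ?_
  obtain ⟨M, hM, hML⟩ := exists_machine_of_mem_finP hL
  exact Machine.mem_finCD_of_counting hM hML hk hf₁ hf₂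

theorem finCD_t_eq : finCD T X .t = finP T X :=
  finCD_eq_finP_of_terminating (fun h => h) le_rfl fun h => h

theorem finCD_t_le_eq (hk : 1 ≤ k) : finCD T X (.and .t (.le k)) = finP T X :=
  finCD_eq_finP_of_terminating And.left hk fun h => ⟨h, le_refl k⟩

theorem finCD_t_eq_eq (hk : 1 ≤ k) : finCD T X (.and .t (.eq k)) = finP T X :=
  finCD_eq_finP_of_terminating And.left hk fun h => ⟨h, rfl⟩

theorem finCD_t_ge_eq (hk : 1 ≤ k) : finCD T X (.and .t (.ge k)) = finP T X :=
  finCD_eq_finP_of_terminating And.left hk fun h => ⟨h, le_refl k⟩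

end Modes

end GrammarSystems

theorem mainTheorem7 {T : Type*} [Finite T] (X : GrammarSystems.RuleType) (k k' : ℕ)
    (hk : 2 ≤ k) (hk' : 1 ≤ k') :
    GrammarSystems.finCD T X .t = GrammarSystems.finP T X ∧
    GrammarSystems.finCD T X (.eq k) = GrammarSystems.finP T X ∧
    GrammarSystems.finCD T X (.ge k) = GrammarSystems.finP T X ∧
    GrammarSystems.allCD T X (.and .t (.eq k)) = GrammarSystems.finP T X ∧
    GrammarSystems.allCD T X (.and .t (.le k)) = GrammarSystems.finP T X ∧
    GrammarSystems.finCD T X (.and .t (.le k')) = GrammarSystems.finP T X ∧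
    GrammarSystems.finCD T X (.and .t (.eq k')) = GrammarSystems.finP T X ∧
    GrammarSystems.finCD T X (.and .t (.ge k')) = GrammarSystems.finP T X := by
  have hk₁ : 1 ≤ k := one_le_two.trans hk
  refine ⟨GrammarSystems.finCD_t_eq,
    GrammarSystems.finCD_eq_finP_of_counting hk (fun h => le_of_eq h.symm) rfl,
    GrammarSystems.finCD_eq_finP_of_counting hk (fun h => h) (le_refl k),
    GrammarSystems.allCD_eq_finP (fun h => ⟨le_of_eq h.2, h.1⟩) (GrammarSystems.finCD_t_eq_eq hk₁),
    GrammarSystems.allCD_eq_finP (fun h => ⟨h.2, h.1⟩) (GrammarSystems.finCD_t_le_eq hk₁),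
    GrammarSystems.finCD_t_le_eq hk', GrammarSystems.finCD_t_eq_eq hk',
    GrammarSystems.finCD_t_ge_eq hk'⟩
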